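/- **Setting.** Fix a finite set $I$ of agents with $|I|\ge 2$, an attention bound $N\in\mathbb N$, and a countably infinite set $\Phi$ of proposition atoms. Formulas are given by $$\varphi::=\top\mid p\mid(\alpha_i<n)\mid(\alpha_i=n)\mid\neg\varphi\mid\varphi\wedge\varphi\mid K_i\varphi\qquad(p\in\Phi,\ i\in I,\ 0\le n\le N).$$ An *attention state* is a pair $(M,w)$, $M=(W,R,V,A)$, where $W$ is a finite set of worlds, $w\in W$, each $R_i$ ($i\in I$) is an equivalence relation on $W$, $V:\Phi\to\mathcal P(W)$, and $A_i:W\to\{0,\dots,N\}$ satisfies $A_i(u)=A_i(v)$ whenever $uR_iv$. Satisfaction is the usual Kripke semantics, where $K_i$ quantifies over the $R_i$-successors, $M,w\vDash(\alpha_i<n)$ iff $A_i(w)<n$, and $M,w\vDash(\alpha_i=n)$ iff $A_i(w)=n$. We write $\varphi\vDash\psi$ if every attention state satisfying $\varphi$ satisfies $\psi$. An *attention action* is $X=((E,Q,Q^*,pre,c),q,e)$, where $E$ is a finite set of events, $e\in E$ is the actual event, $Q_i$ and $Q_i^*$ ($i\in I$) are equivalence relations on $E$, $pre$ assigns a formula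 to each event, $q$ assigns a formula $q_i$ (a question) to each agent, and the cost function $c$ assigns a number $c_i(\varphi,f)\in\mathbb N$ to each agent $i$, formula $\varphi$ and event $f$, such that $c_i(\top,f)=0$ and $c_i(\varphi,f)=c_i(\varphi,g)$ whenever $(f,g)\in Q_i\cup Q_i^*$. $X$ is *applicable* to $(M,w)$ if $M,w\vDash pre(e)$; the *update* of $(M,w)$ with $X$ then has the worlds $(v,f)\in W\times E$ with $M,v\vDash pre(f)$, the actual world $(w,e)$, the valuation inherited from $V$, the attention values $A_i(v,f)=\max\{0,A_i(v)-c_i(q_i,f)\}$, and $(v,f)$ is related to $(u,g)$ for $i$ iff $vR_iu$ and either $(f,g)\in Q_i$, or $(f,g)\in Q_i^*$ and it is not the case that $c_i(q_i,f)\le A_i(v)\ne0$, $pre(f)\vDash q_i$ and $pre(g)\not\vDash q_i$. Iterated updates are computed by the same clauses. An *attention planning task* $(s_0,\Sigma,\varphi_g)$ consists of an attention state $s_0$, a finite set $\Sigma$ of attention actions, and a formula $\varphi_g$. A *solution* is a finite sequence of actions from $\Sigma$ that are successively applicable, starting in $s_0$, and lead to a state satisfying $\varphi_g$. **Theorem.**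 The plan existence problem for attention planning tasks with arbitrary attention actions is undecidable: no algorithm, given (a finite description of) an attention planning task, determines whether the task has a solution. Here a task is described by the finite tables of its relations, attention values, preconditions, questions and goal, together with the finite parts of its valuation and cost functions that matter for the existence of a solution (the atoms up to a bound above those occurring in the goal and the preconditions; the costs of the questions asked). -/

import Mathlib

namespace AttentionPlanning

/-! Epistemic planning with attention. The agents are `Fin m`, the attention bound is `N`, and the
proposition atoms are the natural numbers. -/

/-- The epistemic language, with attention atoms `α_i < n` and `α_i = n` for `n ≤ N`. -/
inductive Formula (m N : ℕ) : Type
  | top : Formula m N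
  | atom (p : ℕ) : Formula m N
  | attLt (i : Fin m) (n : Fin (N + 1)) : Formula m N
  | attEq (i : Fin m) (n : Fin (N + 1)) : Formula m N
  | neg (φ : Formula m N) : Formula m N
  | and (φ ψ : Formula m N) : Formula m N
  | know (i : Fin m) (φ : Formula m N) : Formula m N

/-- A Kripke model with an attention value for every agent at every world; the conditions that make
it an attention model are in `Model.IsAttentionModel`. The truth values of the attention atoms are
determined by `att`, so `val` is needed for the proposition atoms only. -/
structure Model (m : ℕ) (W : Type) : Type where
  rel : Fin m → W → W → Prop
  val : ℕ → Set W
  att : Fin m → W → ℕ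

/-- Attention models with bound `N`: finitely many worlds, equivalence relations, attention values
in `{0, ..., N}`, and every agent knows their own attention value. (Non-emptiness comes with the
actual world.) -/
structure Model.IsAttentionModel {m : ℕ} {W : Type} (N : ℕ) (M : Model m W) : Prop where
  finite : Finite W
  equivalence : ∀ i, Equivalence (M.rel i)
  att_le : ∀ i w, M.att i w ≤ N
  att_eq : ∀ i w v, M.rel i w v → M.att i w = M.att i v

/-- Satisfaction `M, w ⊨ φ`. -/
def Model.Sat {m N : ℕ} {W : Type} (M : Model m W) : W → Formula m N → Prop
  | _, .top => True
  | w, .atom p => w ∈ M.val p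
  | w, .attLt i n => M.att i w < n
  | w, .attEq i n => M.att i w = n
  | w, .neg φ => ¬ M.Sat w φ
  | w, .and φ ψ => M.Sat w φ ∧ M.Sat w ψ
  | w, .know i φ => ∀ v, M.rel i w v → M.Sat v φ

/-- `φ ⊨ ψ`: every attention state that satisfies `φ` satisfies `ψ`. -/
def Entails {m N : ℕ} (φ ψ : Formula m N) : Prop :=
  ∀ (W : Type) (M : Model m W), M.IsAttentionModel N → ∀ w : W, M.Sat w φ → M.Sat w ψ

/-- An attention action `(𝒜, ¤, e)`: an attention action model with `size` many events, a question
for every agent, and an actual event. -/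
structure Action (m N : ℕ) : Type where
  size : ℕ
  Q : Fin m → Fin size → Fin size → Prop
  Qstar : Fin m → Fin size → Fin size → Prop
  pre : Fin size → Formula m N
  cost : Fin m → Formula m N → Fin size → ℕ
  question : Fin m → Formula m N
  actual : Fin size
  Q_equivalence : ∀ i, Equivalence (Q i)
  Qstar_equivalence : ∀ i, Equivalence (Qstar i)
  cost_top : ∀ i e, cost i .top e = 0
  cost_eq : ∀ i e f, Q i e f ∨ Qstar i e f → ∀ φ, cost i φ e = cost i φ f

/-- `Q*_i[φ|¬φ]`: remove from `Q*_i` the pairs `(e, f)` with `pre e ⊨ φ` and not `pre f ⊨ φ`. -/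
def Action.refine {m N : ℕ} (X : Action m N) (i : Fin m) (φ : Formula m N)
    (e f : Fin X.size) : Prop :=
  X.Qstar i e f ∧ ¬ (Entails (X.pre e) φ ∧ ¬ Entails (X.pre f) φ)

/-- The event relation of agent `i` in an update, at an event `e` and a current attention value `a`.
The question is effective if `i` can pay for it and has some attention left (`c ≤ a ≠ 0`); otherwise
all pairs of `Q*` remain. -/
def Action.link {m N : ℕ} (X : Action m N) (i : Fin m) (a : ℕ) (e f : Fin X.size) : Prop :=
  X.Q i e f ∨
    ((X.cost i (X.question i) e ≤ a ∧ a ≠ 0) ∧ X.refine i (X.question i) e f ∨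
     ¬ (X.cost i (X.question i) e ≤ a ∧ a ≠ 0) ∧ X.Qstar i e f)

/-- The attention update. The subtraction in `att` is the truncated one, `max {0, a - c}`. -/
def Model.update {m N : ℕ} {W : Type} (M : Model m W) (X : Action m N) :
    Model m {x : W × Fin X.size // M.Sat x.1 (X.pre x.2)} where
  rel i x y := M.rel i x.1.1 y.1.1 ∧ X.link i (M.att i x.1.1) x.1.2 y.1.2
  val p := {x | x.1.1 ∈ M.val p}
  att i x := M.att i x.1.1 - X.cost i (X.question i) x.1.2

/-- The plan consisting of the listed actions, in this order, is applicable to `(M, w)` and leads to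
a state that satisfies `g`. -/
def Achieves {m N : ℕ} (g : Formula m N) :
    List (Action m N) → (W : Type) → Model m W → W → Prop
  | [], _, M, w => M.Sat w g
  | X :: l, _, M, w => ∃ h : M.Sat w (X.pre X.actual), Achieves g l _ (M.update X) ⟨(w, X.actual), h⟩

/-- An attention planning task: an initial attention state whose worlds are `Fin size`, a finite set
of attention actions (listed), and a goal formula. -/
structure Task (m N : ℕ) : Type where
  size : ℕ
  model : Model m (Fin size)
  isAttentionModel : model.IsAttentionModel N
  world : Fin size
  actions : List (Action m N)
  goal : Formula m N

/-- The task has a solution. -/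
def Task.HasSolution {m N : ℕ} (T : Task m N) : Prop :=
  ∃ l : List (Action m N), (∀ X ∈ l, X ∈ T.actions) ∧ Achieves T.goal l _ T.model T.world

/-! ### Finite descriptions of tasks -/

/-- A formula as a word, in prefix notation. -/
def Formula.code {m N : ℕ} : Formula m N → List ℕ
  | .top => [0]
  | .atom p => [1, p]
  | .attLt i n => [2, i, n]
  | .attEq i n => [3, i, n]
  | .neg φ => 4 :: φ.code
  | .and φ ψ => 5 :: (φ.code ++ ψ.code)
  | .know i φ => 6 :: i :: φ.code

/-- The least number that is larger than all proposition atoms of a formula. -/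
def Formula.bound {m N : ℕ} : Formula m N → ℕ
  | .top => 0
  | .atom p => p + 1
  | .attLt _ _ => 0
  | .attEq _ _ => 0
  | .neg φ => φ.bound
  | .and φ ψ => max φ.bound ψ.bound
  | .know _ φ => φ.bound

open Classical in
/-- The truth table of a binary relation. -/
noncomputable def table {k n : ℕ} (r : Fin k → Fin n → Prop) : List (List Bool) :=
  List.ofFn fun a => List.ofFn fun b => decide (r a b)

/-- The list of the values of a function of two arguments. -/
def values {k n : ℕ} (f : Fin k → Fin n → ℕ) : List (List ℕ) :=
  List.ofFn fun a => List.ofFn fun b => f a b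

/-- Descriptions of actions: number of events, `Q`, `Q*`, preconditions, questions, costs of the
questions, actual event. -/
abbrev ActionCode : Type :=
  ℕ × List (List (List Bool)) × List (List (List Bool)) × List (List ℕ) × List (List ℕ) ×
    List (List ℕ) × ℕ

/-- Descriptions of tasks: number of worlds, accessibility relations, valuation, attention values,
actual world; actions; goal. -/
abbrev TaskCode : Type :=
  (ℕ × List (List (List Bool)) × List (List Bool) × List (List ℕ) × ℕ) × List ActionCode × List ℕ

/-- The description of an action. A cost function has infinitely many values; the description gives
the costs of the questions asked, and these are the only ones that updates depend on. -/
noncomputable def Action.code {m N : ℕ} (X : Action m N) : ActionCode :=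
  (X.size, List.ofFn fun i => table (X.Q i), List.ofFn fun i => table (X.Qstar i),
    List.ofFn fun e => (X.pre e).code, List.ofFn fun i => (X.question i).code,
    values fun i e => X.cost i (X.question i) e, X.actual)

/-- The least number that is larger than all proposition atoms of the preconditions. -/
def Action.bound {m N : ℕ} (X : Action m N) : ℕ :=
  Finset.univ.sup fun e => (X.pre e).bound

/-- A number that is larger than all proposition atoms of the goal and the preconditions. -/
def Task.bound {m N : ℕ} (T : Task m N) : ℕ :=
  max T.goal.bound ((T.actions.map Action.bound).foldr max 0)

/-- The description of a task. The valuation is given for the atoms below `T.bound`, which include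
all those that the existence of a solution depends on. -/
noncomputable def Task.code {m N : ℕ} (T : Task m N) : TaskCode :=
  ((T.size, List.ofFn fun i => table (T.model.rel i),
      table fun (p : Fin T.bound) w => w ∈ T.model.val p,
      values T.model.att, T.world),
    T.actions.map Action.code, T.goal.code)

/-! ### The description of a task determines whether it has a solution -/

theorem Formula.code_append_inj {m N : ℕ} (φ : Formula m N) : ∀ (ψ : Formula m N) (l l' : List ℕ),
    φ.code ++ l = ψ.code ++ l' → φ = ψ ∧ l = l' := by
  induction φ with
  | and φ₁ φ₂ h₁ h₂ =>
    intro ψ l l' h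
    cases ψ with
    | and ψ₁ ψ₂ =>
      simp only [code, List.cons_append, List.append_assoc, List.cons.injEq, true_and] at h
      obtain ⟨rfl, h'⟩ := h₁ _ _ _ h
      obtain ⟨rfl, h''⟩ := h₂ _ _ _ h'
      exact ⟨rfl, h''⟩
    | _ => simp [code] at h
  | neg φ ih =>
    intro ψ l l' h
    cases ψ with
    | neg ψ =>
      simp only [code, List.cons_append, List.cons.injEq, true_and] at h
      obtain ⟨rfl, h'⟩ := ih _ _ _ h
      exact ⟨rfl, h'⟩
    | _ => simp [code] at h
  | know i φ ih =>
    intro ψ l l' h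
    cases ψ with
    | know j ψ =>
      simp only [code, List.cons_append, List.cons.injEq, true_and] at h
      obtain ⟨rfl, h'⟩ := ih _ _ _ h.2
      exact ⟨by rw [Fin.ext h.1], h'⟩
    | _ => simp [code] at h
  | _ =>
    intro ψ l l' h
    cases ψ <;> simp_all [code, Fin.ext_iff]

theorem Formula.code_injective {m N : ℕ} : Function.Injective (Formula.code (m := m) (N := N)) :=
  fun φ ψ h => (φ.code_append_inj ψ [] [] (by simp [h])).1

theorem table_inj {k n : ℕ} {r s : Fin k → Fin n → Prop} (h : table r = table s) : r = s := by
  have := List.ofFn_injective h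
  funext a b
  have h1 := congrFun (List.ofFn_injective (congrFun this a)) b
  simpa using h1

theorem values_inj {k n : ℕ} {r s : Fin k → Fin n → ℕ} (h : values r = values s) : r = s := by
  have := List.ofFn_injective h
  funext a b
  exact congrFun (List.ofFn_injective (congrFun this a)) b

/-- Two models are the same up to atoms `≥ B`. -/
structure Sim {m : ℕ} (B : ℕ) {W W' : Type} (M : Model m W) (M' : Model m W') (f : W ≃ W') : Prop where
  rel : ∀ i w v, M.rel i w v ↔ M'.rel i (f w) (f v)
  val : ∀ p < B, ∀ w, w ∈ M.val p ↔ f w ∈ M'.val p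
  att : ∀ i w, M.att i w = M'.att i (f w)

theorem Sim.sat {m N B : ℕ} {W W' : Type} {M : Model m W} {M' : Model m W'} {f : W ≃ W'}
    (h : Sim B M M' f) (φ : Formula m N) : φ.bound ≤ B → ∀ w, M.Sat w φ ↔ M'.Sat (f w) φ := by
  induction φ with
  | know i φ ih =>
    intro hb w
    simp only [Model.Sat]
    rw [← f.forall_congr_right (q := fun v => M'.rel i (f w) v → M'.Sat v φ)]
    simp only [h.rel, ih hb]
  | and φ ψ h1 h2 =>
    intro hb w
    simp only [Formula.bound, max_le_iff] at hb
    simp only [Model.Sat, h1 hb.1, h2 hb.2]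
  | neg φ ih => intro hb w; simp only [Model.Sat, ih hb]
  | atom p => intro hb w; exact h.val p hb w
  | _ => intro hb w; simp [Model.Sat, h.att]

/-- Two actions differ at most in the costs of questions not asked. -/
inductive Same {m N : ℕ} : Action m N → Action m N → Prop
  | mk (n Q R p c d q a h1 h2 h3 h4 h5 h6 h7 h8) (h : ∀ i e, c i (q i) e = d i (q i) e) :
    Same ⟨n, Q, R, p, c, q, a, h1, h2, h3, h4⟩ ⟨n, Q, R, p, d, q, a, h5, h6, h7, h8⟩

theorem same_of_code {m N : ℕ} {X Y : Action m N} (h : X.code = Y.code) : Same X Y := by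
  obtain ⟨n, Q, R, p, c, q, a, h1, h2, h3, h4⟩ := X
  obtain ⟨n', Q', R', p', d, q', a', h5, h6, h7, h8⟩ := Y
  simp only [Action.code, Prod.mk.injEq] at h
  obtain ⟨rfl, hQ, hR, hp, hq, hc, ha⟩ := h
  obtain rfl : Q = Q' := funext fun i => table_inj (congrFun (List.ofFn_injective hQ) i)
  obtain rfl : R = R' := funext fun i => table_inj (congrFun (List.ofFn_injective hR) i)
  obtain rfl : p = p' := funext fun i => Formula.code_injective (congrFun (List.ofFn_injective hp) i)
  obtain rfl : q = q' := funext fun i => Formula.code_injective (congrFun (List.ofFn_injective hq) i)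
  obtain rfl : a = a' := Fin.ext ha
  exact .mk _ _ _ _ _ _ _ _ _ _ _ _ _ _ _ _ fun i e => congrFun (congrFun (values_inj hc) i) e

theorem achieves_of_same {m N B : ℕ} {g : Formula m N} (hg : g.bound ≤ B) {l l' : List (Action m N)}
    (h : List.Forall₂ Same l l') : (∀ X ∈ l, X.bound ≤ B) → ∀ {W W' : Type} {M : Model m W}
    {M' : Model m W'} {f : W ≃ W'} (_ : Sim B M M' f) (w : W),
    Achieves g l W M w → Achieves g l' W' M' (f w) := by
  induction h with
  | nil => intro _ W W' M M' f hs w h; exact (hs.sat g hg w).1 h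
  | @cons X Y l l' hXY hl ih =>
    intro hb W W' M M' f hs w ⟨h0, hach⟩
    have hX : X.bound ≤ B := hb X (by simp)
    have hb' : ∀ Z ∈ l, Z.bound ≤ B := fun Z hZ => hb Z (by simp [hZ])
    obtain ⟨n, Q, R, p, c, d, q, a, h1, h2, h3, h4, h5, h6, h7, h8, hc⟩ := hXY
    have hp : ∀ e, (p e).bound ≤ B := fun e =>
      (Finset.le_sup (f := fun e => (p e).bound) (Finset.mem_univ e)).trans hX
    let F : {x : W × Fin n // M.Sat x.1 (p x.2)} ≃ {x : W' × Fin n // M'.Sat x.1 (p x.2)} :=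
      (f.prodCongr (Equiv.refl _)).subtypeEquiv fun x => hs.sat _ (hp x.2) x.1
    refine ⟨(hs.sat _ (hp a) w).1 h0, ?_⟩
    refine ih hb' (f := F) ⟨?_, ?_, ?_⟩ _ hach
    · intro i x y
      simp only [Model.update, Action.link, Action.refine, hs.rel, hs.att, hc]
      rfl
    · intro k hk x
      exact hs.val k hk x.1.1
    · intro i x
      simp only [Model.update, hs.att, hc]
      rfl

/-- The description of a task determines whether the task has a solution. -/
theorem hasSolution_of_code {m N : ℕ} {T T' : Task m N} (h : T.code = T'.code)
    (hT : T.HasSolution) : T'.HasSolution := by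
  obtain ⟨n, M, hM, w, A, g⟩ := T
  obtain ⟨n', M', hM', w', A', g'⟩ := T'
  simp only [Task.code, Prod.mk.injEq] at h
  obtain ⟨⟨rfl, hr, hv, ha, hw⟩, hA, hg⟩ := h
  obtain rfl := Formula.code_injective hg
  obtain rfl : w = w' := Fin.ext hw
  have hAA : List.Forall₂ Same A A' := by
    rw [← List.forall₂_eq_eq_eq, List.forall₂_map_left_iff, List.forall₂_map_right_iff] at hA
    exact hA.imp fun _ _ h => same_of_code h
  have key : ∀ X ∈ A, X.bound ≤ Task.bound ⟨n, M, hM, w, A, g⟩ := by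
    intro X hX
    refine le_trans ?_ (le_max_right _ _)
    clear hA hAA hv hT
    induction A with
    | nil => simp at hX
    | cons Y A ih =>
      simp only [List.map_cons, List.foldr_cons]
      rcases List.mem_cons.1 hX with rfl | h
      · exact le_max_left _ _
      · exact (ih h).trans (le_max_right _ _)
  have hB : Task.bound ⟨n, M, hM, w, A, g⟩ = Task.bound ⟨n, M', hM', w, A', g⟩ := by
    have : A.map Action.bound = A'.map Action.bound := by
      rw [← List.forall₂_eq_eq_eq, List.forall₂_map_left_iff, List.forall₂_map_right_iff]
      exact hAA.imp fun _ _ h => by cases h; rfl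
    simp only [Task.bound, this]
  have hs : Sim (Task.bound ⟨n, M, hM, w, A, g⟩) M M' (Equiv.refl _) := by
    refine ⟨fun i x y => ?_, fun p hp x => ?_, fun i x => ?_⟩
    · have := table_inj (congrFun (List.ofFn_injective hr) i)
      exact iff_of_eq (congrFun (congrFun this x) y)
    · generalize Task.bound ⟨n, M, hM, w, A, g⟩ = b at *
      subst hB
      have := table_inj hv
      exact iff_of_eq (congrFun (congrFun this ⟨p, hp⟩) x)
    · exact congrFun (congrFun (values_inj ha) i) x
  obtain ⟨l, hl, hach⟩ := hT
  have : ∃ l', List.Forall₂ Same l l' ∧ ∀ X ∈ l', X ∈ A' := by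
    clear hach
    induction l with
    | nil => exact ⟨[], .nil, by simp⟩
    | cons X l ih =>
      obtain ⟨l', h1, h2⟩ := ih fun Y hY => hl Y (by simp [hY])
      have hX : X ∈ A := hl X (by simp)
      obtain ⟨i, hi, rfl⟩ := List.getElem_of_mem hX
      have hi' : i < A'.length := hAA.length_eq ▸ hi
      refine ⟨A'[i] :: l', .cons (hAA.get hi hi') h1, ?_⟩
      intro Y hY
      rcases List.mem_cons.1 hY with rfl | h
      · exact List.getElem_mem hi'
      · exact h2 Y h
  obtain ⟨l', h1, h2⟩ := this
  exact ⟨l', h2, achieves_of_same (le_max_left _ _) h1 (fun X hX => key X (hl X hX)) hs w hach⟩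

/-- The class of all attention actions. -/
def ALL (m N : ℕ) : Set (Action m N) := Set.univ

/-- Decidability of the plan existence problem for tasks with actions from the class `𝒳`: an
algorithm that, on the description of any such task, says whether the task has a solution. -/
def PlanExDecidable {m N : ℕ} (𝒳 : Set (Action m N)) : Prop :=
  ∃ D : TaskCode → Bool, Computable D ∧
    ∀ T : Task m N, (∀ X ∈ T.actions, X ∈ 𝒳) → (D T.code = true ↔ T.HasSolution)

end AttentionPlanning

/-! The halting problem of a fixed Turing machine reduces to plan existence, and attention plays no
role in the reduction: all attention values are 0 and all questions are ⊤. Refining by ⊤ removes no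
pairs, so the event relation of an update is `Q ∪ Q*`. Both are equivalence relations, but their
union need not be transitive. Hence the initial state is an attention model, while updates can turn
the relation of agent 0 into the adjacency of a reflexive symmetric graph, such as a path.

A labelled graph is coded by a model (`LGraph.model`) whose actual world is a hub. Agent 0 carries
adjacency; the other agents let the hub see every world, and a marker tells the vertices from spare
copies, one per label. An action with six events (`Rule.action`) tests a condition at the hub, drops
the vertices that satisfy one formula, and turns a spare copy into a new vertex adjacent to exactly
the remaining vertices that satisfy another. `strongHom_rewrite` shows that the updated model is
indistinguishable from the model of the rewritten graph.

A machine configuration is a path of cells together with a head vertex adjacent to the scanned cell.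
Adjacency is symmetric, so left and right are told apart by labelling cells with their position
modulo 3. As a rule adds only one vertex, the work is divided: the head carries the scanned symbol,
writing changes only the head, and before a move the symbol is copied to the cell and, if necessary,
a blank cell is added. The input is guessed: actions append arbitrary cells, and the action that
creates the head tests that the tape holds the input. So the input affects only one precondition.

Every applicable action preserves an invariant that ties the graph to a reachable machine
configuration (`Config.Valid.exists_step`); conversely, every halting run yields a plan
(`canHalt_of_reaches`). The description of the task is computable from the input
(`computable_code_haltingTask`), so deciding plan existence would decide halting. -/

set_option linter.unusedSectionVars false

namespace AttentionPlanning

open Turing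

/-! ### A finite Turing machine with undecidable halting problem -/

section Machines

/-- The machine reaches a halting configuration from the initial tape `l`. -/
def MachineHalts {Γ Q : Type} [Inhabited Γ] [Inhabited Q] (M : TM0.Machine Γ Q) (l : List Γ) : Prop :=
  ∃ c, TM0.Reaches M (TM0.init l) c ∧ TM0.step M c = none

theorem machineHalts_iff_dom {Γ Q : Type} [Inhabited Γ] [Inhabited Q] (M : TM0.Machine Γ Q)
    (l : List Γ) : MachineHalts M l ↔ (TM0.eval M l).Dom := by
  rw [TM0.eval, Part.dom_iff_mem]
  simp only [Part.mem_map_iff, StateTransition.mem_eval]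
  constructor
  · rintro ⟨c, h⟩; exact ⟨_, c, h, rfl⟩
  · rintro ⟨_, c, h, -⟩; exact ⟨c, h⟩

/-- The emulations of stack machines may have infinitely many states, of which only those in a
finite support are reached. Retracting the states onto the support does not affect runs. -/
theorem exists_finite_machine {Γ Q : Type} [Inhabited Γ] [Inhabited Q] (M : TM0.Machine Γ Q)
    {S : Finset Q} (hS : TM0.Supports M (S : Set Q)) :
    ∃ (Q' : Type) (_ : Finite Q') (_ : Inhabited Q') (M' : TM0.Machine Γ Q'),
      ∀ l, MachineHalts M' l ↔ MachineHalts M l := by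
  classical
  let d : S := ⟨default, hS.1⟩
  let _ : Inhabited S := ⟨d⟩
  let g₁ : PointedMap Q S := ⟨fun q => if h : q ∈ S then ⟨q, h⟩ else d, by
    simp only [dif_pos (show default ∈ S from hS.1)]; rfl⟩
  let f : PointedMap Γ Γ := ⟨id, rfl⟩
  refine ⟨S, inferInstance, inferInstance, M.map f f g₁ Subtype.val, fun l => ?_⟩
  have hr := TM0.Machine.map_respects M f f g₁ Subtype.val hS (fun _ => rfl)
    (fun q hq => by
      change ((if h : q ∈ S then (⟨q, h⟩ : S) else d) : S).1 = q
      rw [dif_pos (by exact hq)])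
  have h0 : (TM0.init l : TM0.Cfg Γ Q).map f g₁ = TM0.init l := by
    rw [TM0.map_init]
    change TM0.init (l.map id) = _
    rw [List.map_id]
  rw [machineHalts_iff_dom, machineHalts_iff_dom]
  exact StateTransition.tr_eval_dom hr ⟨hS.1, h0⟩

theorem exists_partrec_code {f : ℕ →. ℕ} (hf : Partrec f) :
    ∃ c : ToPartrec.Code, ∀ n, (c.eval [n]).Dom ↔ (f n).Dom := by
  have h1 : Partrec fun v : List.Vector ℕ 1 => f v.head :=
    hf.comp (Primrec.vector_head.to_comp)
  obtain ⟨c, hc⟩ := ToPartrec.Code.exists_code (Nat.Partrec'.of_part h1)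
  refine ⟨c, fun n => ?_⟩
  have := hc ⟨[n], rfl⟩
  change c.eval [n] = _ at this
  rw [this]
  rfl

theorem trPosNum_eq_bits (n : PosNum) :
    PartrecToTM2.trPosNum n =
      (n : ℕ).bits.map fun b => bif b then PartrecToTM2.Γ'.bit1 else PartrecToTM2.Γ'.bit0 := by
  induction n with
  | one => simp [PartrecToTM2.trPosNum]
  | bit0 n ih =>
    rw [PosNum.cast_bit0, ← two_mul,
      Nat.bit0_bits _ (PosNum.cast_pos n).ne']
    simp [PartrecToTM2.trPosNum, ih]
  | bit1 n ih =>
    rw [PosNum.cast_bit1, ← two_mul, Nat.bit1_bits]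
    simp [PartrecToTM2.trPosNum, ih]

/-- In terms of `Nat.bits` the input word can later be shown to be primitive recursive in `n`. -/
theorem trNat_eq_bits (n : ℕ) :
    PartrecToTM2.trNat n =
      n.bits.map fun b => bif b then PartrecToTM2.Γ'.bit1 else PartrecToTM2.Γ'.bit0 := by
  rw [PartrecToTM2.trNat]
  conv_rhs => rw [← Num.to_of_nat n]
  cases (n : Num) with
  | zero => simp [PartrecToTM2.trNum]
  | pos k => exact trPosNum_eq_bits k

/-- The tape symbol of the multi-stack emulation that holds `x` on the main stack and nothing on the
others. -/
def mainSymbol (b : Bool) (x : PartrecToTM2.Γ') :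
    TM2to1.Γ' PartrecToTM2.K' fun _ => PartrecToTM2.Γ' :=
  (b, Function.update (fun _ => none) PartrecToTM2.K'.main (some x))

theorem trInit_main {L l : List PartrecToTM2.Γ'} {x : PartrecToTM2.Γ'} (h : L.reverse = x :: l) :
    TM2to1.trInit (K := PartrecToTM2.K') (Γ := fun _ => PartrecToTM2.Γ') PartrecToTM2.K'.main L =
      mainSymbol true x :: l.map (mainSymbol false) := by
  unfold TM2to1.trInit
  rw [h]
  rfl

theorem exists_machine_of_code (c : ToPartrec.Code) :
    ∃ (Γ Q : Type) (_ : Finite Γ) (_ : Inhabited Γ) (_ : Finite Q) (_ : Inhabited Q)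
      (M : TM0.Machine Γ Q) (a : Γ) (g : Bool → Γ),
      ∀ n : ℕ, MachineHalts M (a :: n.bits.reverse.map g) ↔ (c.eval [n]).Dom := by
  classical
  -- The emulations start in the default state, so the entry point of `c` is made the default.
  let _ : Inhabited PartrecToTM2.Λ' := ⟨PartrecToTM2.trNormal c PartrecToTM2.Cont'.halt⟩
  have : Finite PartrecToTM2.K' :=
    Finite.of_surjective (fun i : Fin 4 => (![.main, .rev, .aux, .stack] : Fin 4 → PartrecToTM2.K') i)
      fun k => by
        cases k
        · exact ⟨0, rfl⟩
        · exact ⟨1, rfl⟩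
        · exact ⟨2, rfl⟩
        · exact ⟨3, rfl⟩
  have s2 := PartrecToTM2.tr_supports c PartrecToTM2.Cont'.halt
  have s1 := TM2to1.tr_supports PartrecToTM2.tr s2
  have s0 := TM1to0.tr_supports _ s1
  obtain ⟨Q, hQ, iQ, M, hM⟩ := exists_finite_machine _ s0
  refine ⟨_, Q, ?_, inferInstance, hQ, iQ, M,
    mainSymbol true .cons,
    fun b => mainSymbol false (bif b then .bit1 else .bit0), fun n => ?_⟩
  · change Finite (Bool × (PartrecToTM2.K' → Option PartrecToTM2.Γ'))
    infer_instance
  -- The emulated tape lists the stack from its bottom; thus the terminator `cons` becomes the fixed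
  -- first symbol and the bits come reversed.
  · have e := trInit_main (L := PartrecToTM2.trList [n]) (x := .cons)
      (l := (PartrecToTM2.trNat n).reverse) (by simp [PartrecToTM2.trList])
    rw [trNat_eq_bits, ← List.map_reverse, List.map_map] at e
    change _ = mainSymbol true .cons ::
      n.bits.reverse.map fun b => mainSymbol false (bif b then .bit1 else .bit0) at e
    rw [← e, hM, machineHalts_iff_dom, TM1to0.tr_eval]
    refine (TM2to1.tr_eval_dom PartrecToTM2.tr PartrecToTM2.K'.main
      (PartrecToTM2.trList [n])).trans ?_
    have hi : (TM2.init PartrecToTM2.K'.main (PartrecToTM2.trList [n]) : PartrecToTM2.Cfg') =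
        PartrecToTM2.init c [n] := by
      unfold TM2.init PartrecToTM2.init
      congr 1
      funext k
      cases k <;> rfl
    have h2 := PartrecToTM2.tr_eval c [n]
    rw [← hi] at h2
    unfold TM2.eval
    change (StateTransition.eval (TM2.step PartrecToTM2.tr) _).Dom ↔ _
    rw [h2]
    rfl

/-- A Turing machine whose halting problem, on tapes that hold a binary numeral behind a fixed first
symbol, is undecidable. -/
theorem exists_undecidable_machine :
    ∃ (Γ Q : Type) (_ : Finite Γ) (_ : Inhabited Γ) (_ : Finite Q) (_ : Inhabited Q)
      (M : TM0.Machine Γ Q) (a : Γ) (g : Bool → Γ),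
      ¬ ComputablePred fun n : ℕ => MachineHalts M (a :: n.bits.reverse.map g) := by
  -- A universal function: it runs program number `n` on input 0.
  have hf : Partrec fun n : ℕ => (Denumerable.ofNat Nat.Partrec.Code n).eval 0 :=
    Nat.Partrec.Code.eval_part.comp (Computable.ofNat _) (Computable.const 0)
  obtain ⟨c, hc⟩ := exists_partrec_code hf
  obtain ⟨Γ, Q, h1, h2, h3, h4, M, a, g, h⟩ := exists_machine_of_code c
  refine ⟨Γ, Q, h1, h2, h3, h4, M, a, g, fun hd => ComputablePred.halting_problem 0 ?_⟩
  obtain ⟨f, hf, hfe⟩ := ComputablePred.computable_iff.1 hd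
  refine ComputablePred.computable_iff.2 ⟨fun c => f (Encodable.encode c),
    hf.comp Computable.encode, funext fun d => ?_⟩
  have := congrFun hfe (Encodable.encode d)
  rw [← this]
  refine propext (Iff.trans ?_ ((hc _).symm.trans (h _).symm))
  simp

end Machines

/-! ### Structure-preserving relations between models, and plans -/

section Morphisms

/-- A total and surjective relation between worlds that preserves and reflects the structure of a
model. -/
structure StrongHom {m : ℕ} {W W' : Type} (M : Model m W) (M' : Model m W') (R : W → W' → Prop) :
    Prop where
  total : ∀ x, ∃ y, R x y
  surj : ∀ y, ∃ x, R x y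
  rel : ∀ i x y x' y', R x x' → R y y' → (M.rel i x y ↔ M'.rel i x' y')
  val : ∀ p x y, R x y → (x ∈ M.val p ↔ y ∈ M'.val p)
  att : ∀ i x y, R x y → M.att i x = M'.att i y

variable {m N : ℕ} {W W' : Type} {M : Model m W} {M' : Model m W'}
  {R : W → W' → Prop}

theorem StrongHom.sat (h : StrongHom M M' R) (φ : Formula m N) :
    ∀ x y, R x y → (M.Sat x φ ↔ M'.Sat y φ) := by
  induction φ with
  | know i φ ih =>
    intro x y hxy
    constructor
    · intro hs v hv
      obtain ⟨u, hu⟩ := h.surj v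
      exact (ih _ _ hu).1 (hs u ((h.rel i x u y v hxy hu).2 hv))
    · intro hs u hu
      obtain ⟨v, hv⟩ := h.total u
      exact (ih _ _ hv).2 (hs v ((h.rel i x u y v hxy hv).1 hu))
  | and φ ψ h1 h2 => intro x y hxy; simp only [Model.Sat, h1 x y hxy, h2 x y hxy]
  | neg φ ih => intro x y hxy; simp only [Model.Sat, ih x y hxy]
  | atom p => intro x y hxy; exact h.val p x y hxy
  | _ => intro x y hxy; simp [Model.Sat, h.att _ x y hxy]

/-- Related worlds satisfy the same preconditions, and links depend only on events and attention
values, so pairing worlds with equal events again preserves everything. -/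
theorem StrongHom.update (h : StrongHom M M' R) (X : Action m N) :
    StrongHom (M.update X) (M'.update X) fun x y => R x.1.1 y.1.1 ∧ x.1.2 = y.1.2 where
  total := by
    rintro ⟨⟨x, e⟩, hx⟩
    obtain ⟨y, hy⟩ := h.total x
    exact ⟨⟨(y, e), (h.sat _ x y hy).1 hx⟩, hy, rfl⟩
  surj := by
    rintro ⟨⟨y, e⟩, hy⟩
    obtain ⟨x, hx⟩ := h.surj y
    exact ⟨⟨(x, e), (h.sat _ x y hx).2 hy⟩, hx, rfl⟩
  rel := by
    rintro i x y x' y' ⟨hx, hx'⟩ ⟨hy, hy'⟩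
    simp only [Model.update, h.rel i _ _ _ _ hx hy, h.att i _ _ hx, hx', hy']
  val := by
    rintro p x y ⟨hx, -⟩
    exact h.val p _ _ hx
  att := by
    rintro i x y ⟨hx, hx'⟩
    simp only [Model.update, h.att i _ _ hx, hx']

theorem StrongHom.achieves {g : Formula m N} {l : List (Action m N)} : ∀ {W W' : Type}
    {M : Model m W} {M' : Model m W'} {R : W → W' → Prop}, StrongHom M M' R →
    ∀ {x : W} {y : W'}, R x y → (Achieves g l W M x ↔ Achieves g l W' M' y) := by
  induction l with
  | nil => intro W W' M M' R h x y hxy; exact h.sat g x y hxy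
  | cons X l ih =>
    intro W W' M M' R h x y hxy
    constructor
    · rintro ⟨h1, h2⟩
      exact ⟨(h.sat _ x y hxy).1 h1, (ih (h.update X) ⟨hxy, rfl⟩).1 h2⟩
    · rintro ⟨h1, h2⟩
      exact ⟨(h.sat _ x y hxy).2 h1, (ih (h.update X) ⟨hxy, rfl⟩).2 h2⟩

end Morphisms

/-! ### Labelled graphs as models -/

section Graphs

/-- The sorts of worlds: a hub (`none`), a marker (`some none`), and one sort for every label. -/
abbrev WorldSort (Λ : Type) : Type := Option (Option Λ)

/-- The proposition atom of a sort is a number below the number of sorts. -/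
noncomputable def sortEquiv (Λ : Type) [Finite Λ] : WorldSort Λ ≃ Fin (Nat.card (WorldSort Λ)) :=
  Finite.equivFin _

/-- A labelled graph on a subset of `U`. -/
structure LGraph (U Λ : Type) : Type where
  alive : U → Prop
  lab : U → Λ
  adj : U → U → Prop

/-- The sort is that of a label. -/
def IsLabel {Λ : Type} (a : WorldSort Λ) : Prop := ∃ s, a = some (some s)

variable {U Λ : Type}

/-- The sort of a world in the model of a graph. -/
def LGraph.sort (G : LGraph U Λ) : WorldSort Λ ⊕ {u // G.alive u} → WorldSort Λ
  | .inl a => a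
  | .inr u => some (some (G.lab u.1))

/-- The relation of agent 0 in the model of a graph. -/
def LGraph.rel₀ (G : LGraph U Λ) :
    WorldSort Λ ⊕ {u // G.alive u} → WorldSort Λ ⊕ {u // G.alive u} → Prop
  | .inl a, .inl b => a = b ∨ IsLabel a ∧ IsLabel b
  | .inl a, .inr _ => IsLabel a
  | .inr _, .inl a => IsLabel a
  | .inr u, .inr v => G.adj u.1 v.1

/-- The relation of all other agents in the model of a graph. -/
def LGraph.rel₁ (G : LGraph U Λ) :
    WorldSort Λ ⊕ {u // G.alive u} → WorldSort Λ ⊕ {u // G.alive u} → Prop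
  | .inl _, .inl _ => True
  | .inl a, .inr _ => a = none
  | .inr _, .inl a => a = none
  | .inr u, .inr v => u.1 = v.1

/-- The model of a graph. Besides the vertices it has one world of every sort. The worlds of the
sorts of labels are spare copies from which new vertices are made; agent 0 links them to each other
and to all vertices. The other agents link the hub to all worlds, and they link the marker to
the spare copies but not to the vertices. -/
def LGraph.model (G : LGraph U Λ) [Finite Λ] (m : ℕ) : Model m (WorldSort Λ ⊕ {u // G.alive u}) where
  rel i x y := if i.1 = 0 then G.rel₀ x y else G.rel₁ x y
  val p := {x | (sortEquiv Λ (G.sort x) : ℕ) = p}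
  att _ _ := 0

variable {m N : ℕ}

/-- Possibility. -/
def dia (i : Fin m) (φ : Formula m N) : Formula m N := .neg (.know i (.neg φ))

/-- Disjunction. -/
def disj (φ ψ : Formula m N) : Formula m N := .neg (.and (.neg φ) (.neg ψ))

theorem sat_dia {W : Type} (M : Model m W) (w : W) (i : Fin m) (φ : Formula m N) :
    M.Sat w (dia i φ) ↔ ∃ v, M.rel i w v ∧ M.Sat v φ := by
  simp [dia, Model.Sat]

theorem sat_disj {W : Type} (M : Model m W) (w : W) (φ ψ : Formula m N) :
    M.Sat w (disj φ ψ) ↔ M.Sat w φ ∨ M.Sat w ψ := by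
  simp only [disj, Model.Sat]; tauto

/-- The agent whose relation is the adjacency of a graph. -/
def adjAgent (hm : 2 ≤ m) : Fin m := ⟨0, by omega⟩

/-- An agent who links the hub to all worlds. -/
def hubAgent (hm : 2 ≤ m) : Fin m := ⟨1, by omega⟩

variable (Λ) [Finite Λ] (hm : 2 ≤ m)

variable {Λ} in
/-- The world has the given sort. -/
noncomputable def sortF (a : WorldSort Λ) : Formula m N := .atom (sortEquiv Λ a)

/-- The world is a vertex. -/
noncomputable def vertexF : Formula m N :=
  -- For this agent every world that is not a vertex sees the marker, and no vertex does.
  .and (.neg (sortF (none : WorldSort Λ))) (.neg (dia (hubAgent hm) (sortF (some none : WorldSort Λ))))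

/-- The world is a spare copy. -/
noncomputable def spareF : Formula m N :=
  .and (.neg (sortF (none : WorldSort Λ)))
    (.and (.neg (sortF (some none : WorldSort Λ))) (dia (hubAgent hm) (sortF (some none : WorldSort Λ))))

/-- Some adjacent vertex satisfies the formula. -/
noncomputable def nearF (φ : Formula m N) : Formula m N :=
  -- Agent 0 also links each vertex to all spare copies; the first conjunct excludes them.
  dia (adjAgent hm) (.and (vertexF Λ hm) φ)

/-- Some vertex satisfies the formula. -/
noncomputable def someF (φ : Formula m N) : Formula m N :=
  dia (hubAgent hm) (.and (vertexF Λ hm) φ)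

open Classical in
variable {Λ} in
/-- The label has the given property. -/
noncomputable def labF (P : Λ → Prop) : Formula m N :=
  letI := Fintype.ofFinite Λ
  (Finset.univ : Finset Λ).toList.foldr
    -- The atoms of all labels occur whatever `P` is; this makes `bound_labF` true.
    (fun x φ => disj (.and (sortF (some (some x))) (if P x then .top else .neg .top)) φ) (.neg .top)

variable {Λ} {hm} (G : LGraph U Λ)

theorem sat_sortF {x : WorldSort Λ ⊕ {u // G.alive u}} {a : WorldSort Λ} :
    (G.model m).Sat x (sortF a : Formula m N) ↔ G.sort x = a := by
  change (sortEquiv Λ (G.sort x) : ℕ) = sortEquiv Λ a ↔ _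
  rw [← Fin.ext_iff, (sortEquiv Λ).apply_eq_iff_eq]

theorem sat_hub_dia {x : WorldSort Λ ⊕ {u // G.alive u}} {φ : Formula m N} :
    (G.model m).Sat x (dia (hubAgent hm) φ) ↔ ∃ y, G.rel₁ x y ∧ (G.model m).Sat y φ := by
  rw [sat_dia]; rfl

theorem sat_adj_dia {x : WorldSort Λ ⊕ {u // G.alive u}} {φ : Formula m N} :
    (G.model m).Sat x (dia (adjAgent hm) φ) ↔ ∃ y, G.rel₀ x y ∧ (G.model m).Sat y φ := by
  rw [sat_dia]; rfl

theorem sat_vertexF {x : WorldSort Λ ⊕ {u // G.alive u}} :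
    (G.model m).Sat x (vertexF Λ hm : Formula m N) ↔ ∃ u, x = .inr u := by
  simp only [vertexF, Model.Sat, sat_sortF, sat_hub_dia]
  rcases x with (_ | a) | u <;> simp [LGraph.sort, LGraph.rel₁]

theorem sat_spareF {x : WorldSort Λ ⊕ {u // G.alive u}} :
    (G.model m).Sat x (spareF Λ hm : Formula m N) ↔ ∃ s, x = .inl (some (some s)) := by
  simp only [spareF, Model.Sat, sat_sortF, sat_hub_dia]
  rcases x with (_ | _ | a) | u <;> simp [LGraph.sort, LGraph.rel₁]

theorem sat_nearF {u : {u // G.alive u}} {φ : Formula m N} :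
    (G.model m).Sat (.inr u) (nearF Λ hm φ) ↔
      ∃ v, ∃ h : G.alive v, G.adj u.1 v ∧ (G.model m).Sat (.inr ⟨v, h⟩) φ := by
  simp only [nearF, sat_adj_dia, Model.Sat, sat_vertexF]
  constructor
  · rintro ⟨_, h, ⟨v, rfl⟩, h2⟩; exact ⟨v.1, v.2, h, h2⟩
  · rintro ⟨v, hv, h, h2⟩; exact ⟨.inr ⟨v, hv⟩, h, ⟨⟨v, hv⟩, rfl⟩, h2⟩

theorem sat_someF {φ : Formula m N} :
    (G.model m).Sat (.inl none) (someF Λ hm φ) ↔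
      ∃ v, ∃ h : G.alive v, (G.model m).Sat (.inr ⟨v, h⟩) φ := by
  simp only [someF, sat_hub_dia, Model.Sat, sat_vertexF]
  constructor
  · rintro ⟨_, h, ⟨v, rfl⟩, h2⟩; exact ⟨v.1, v.2, h2⟩
  · rintro ⟨v, hv, h2⟩; exact ⟨.inr ⟨v, hv⟩, rfl, ⟨⟨v, hv⟩, rfl⟩, h2⟩

theorem sat_labF {u : {u // G.alive u}} {P : Λ → Prop} :
    (G.model m).Sat (.inr u) (labF P : Formula m N) ↔ P (G.lab u.1) := by
  classical
  have key : ∀ l : List Λ, (G.model m).Sat (.inr u) (l.foldr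
      (fun x φ => disj (.and (sortF (some (some x))) (if P x then .top else .neg .top)) φ)
      (.neg .top) : Formula m N) ↔ G.lab u.1 ∈ l ∧ P (G.lab u.1) := by
    intro l
    induction l with
    | nil => simp [Model.Sat]
    | cons x l ih =>
      rw [List.foldr_cons, sat_disj, ih]
      simp only [Model.Sat, sat_sortF, LGraph.sort, Option.some.injEq, List.mem_cons]
      by_cases hx : G.lab u.1 = x
      · subst hx
        by_cases hP : P (G.lab u.1) <;> simp [hP, Model.Sat]
      · simp [hx]
  rw [labF, key]
  simp

end Graphs

/-! ### Graph rewriting by updates -/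

section Rules

/-- A rewriting rule for graphs: if the condition holds, drop some vertices and add a new one. -/
structure Rule (m N : ℕ) (Λ : Type) : Type where
  cond : Formula m N
  drop : Formula m N
  link : Formula m N
  new : Λ

variable {m N : ℕ} {Λ : Type} [Finite Λ]

/-- The preconditions of the six events of a rule: the hub, the marker, the spare copies, the
vertices without and with a link to the new vertex, and the new vertex. -/
noncomputable def Rule.pre (hm : 2 ≤ m) (r : Rule m N Λ) : Fin 6 → Formula m N :=
  ![.and (sortF (none : WorldSort Λ)) r.cond, sortF (some none : WorldSort Λ), spareF Λ hm,
    .and (vertexF Λ hm) (.and (.neg r.drop) (.neg r.link)),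
    .and (vertexF Λ hm) (.and (.neg r.drop) r.link),
    .and (spareF Λ hm) (sortF (some (some r.new)))]

/-- The classes of `Q`. Questions are trivial, so that the event relation of an update is the union of
`Q` and `Q*`, which need not be transitive; see `Rule.link_action`. -/
def blockQ {m : ℕ} (i : Fin m) : Fin 6 → ℕ := if i.1 = 0 then ![0, 1, 2, 2, 2, 3] else ![0, 1, 2, 0, 0, 0]

/-- The classes of `Q*`. -/
def blockQstar {m : ℕ} (i : Fin m) : Fin 6 → ℕ :=
  -- For agent 0, event 4 shares a class with 3 in `Q` and with 5 in `Q*`, but 3 and 5 share none: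
  -- the new vertex is adjacent to the linked vertices only. For the others, `Q` joins the hub to
  -- the vertex events and `Q*` joins it to the marker and the spare copies, so the last two stay
  -- separated from the vertices.
  if i.1 = 0 then ![0, 1, 2, 3, 2, 2] else ![0, 0, 0, 1, 2, 3]

/-- The action that performs a rule. -/
noncomputable def Rule.action (hm : 2 ≤ m) (r : Rule m N Λ) : Action m N where
  size := 6
  Q i e f := blockQ i e = blockQ i f
  Qstar i e f := blockQstar i e = blockQstar i f
  pre := r.pre hm
  cost _ _ _ := 0
  question _ := .top
  actual := 0
  Q_equivalence _ := ⟨fun _ => rfl, fun h => h.symm, fun h h' => h.trans h'⟩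
  Qstar_equivalence _ := ⟨fun _ => rfl, fun h => h.symm, fun h h' => h.trans h'⟩
  cost_top _ _ := rfl
  cost_eq _ _ _ _ _ := rfl

/-- Every precondition entails ⊤, so refinement discards nothing, and it does not matter whether the
question is effective. -/
theorem Rule.link_action (hm : 2 ≤ m) (r : Rule m N Λ) (i : Fin m) (a : ℕ) (e f : Fin 6) :
    (r.action hm).link i a e f ↔ blockQ i e = blockQ i f ∨ blockQstar i e = blockQstar i f := by
  have h : Entails ((r.action hm).pre f) ((r.action hm).question i) := fun _ _ _ _ _ => trivial
  have h2 : (r.action hm).refine i ((r.action hm).question i) e f ↔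
      blockQstar i e = blockQstar i f := by
    unfold Action.refine
    exact ⟨fun h => h.1, fun h' => ⟨h', fun h'' => h''.2 h⟩⟩
  unfold Action.link
  rw [h2]
  change _ ∨ (_ ∧ _ ∨ _ ∧ blockQstar i e = blockQstar i f) ↔ _
  rw [← or_and_right]
  simp only [em, true_and]
  rfl

/-- `G'` is obtained from `G` by dropping the vertices in `D` and adding a vertex `u` with label `x`
that is adjacent to the remaining vertices in `A`. -/
structure IsRewrite {U : Type} (G G' : LGraph U Λ) (D A : U → Prop) (u : U) (x : Λ) : Prop where
  alive : ∀ v, G'.alive v ↔ (G.alive v ∧ ¬ D v) ∨ v = u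
  fresh : ∀ v, G.alive v → ¬ D v → v ≠ u
  lab_new : G'.lab u = x
  lab_old : ∀ v, G.alive v → ¬ D v → G'.lab v = G.lab v
  adj_old : ∀ v w, G.alive v → ¬ D v → G.alive w → ¬ D w → (G'.adj v w ↔ G.adj v w)
  adj_new : G'.adj u u
  adj_left : ∀ v, G.alive v → ¬ D v → (G'.adj u v ↔ A v)
  adj_right : ∀ v, G.alive v → ¬ D v → (G'.adj v u ↔ A v)

variable {U : Type} {G G' : LGraph U Λ} {D A : U → Prop} {u : U} {hm : 2 ≤ m} {r : Rule m N Λ}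

/-- The possible worlds of the update of a graph model with the action of a rule. -/
theorem Rule.sat_pre (hD : ∀ v (h : G.alive v), (G.model m).Sat (.inr ⟨v, h⟩) r.drop ↔ D v)
    (hA : ∀ v (h : G.alive v), (G.model m).Sat (.inr ⟨v, h⟩) r.link ↔ A v)
    (x : WorldSort Λ ⊕ {u // G.alive u}) (e : Fin 6) :
    (G.model m).Sat x ((r.action hm).pre e) ↔
      (x = .inl none ∧ e = 0 ∧ (G.model m).Sat (.inl none) r.cond) ∨
      (x = .inl (some none) ∧ e = 1) ∨ ((∃ s, x = .inl (some (some s))) ∧ e = 2) ∨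
      (∃ v, x = .inr v ∧ ¬ D v.1 ∧ (e = 3 ∧ ¬ A v.1 ∨ e = 4 ∧ A v.1)) ∨
      (x = .inl (some (some r.new)) ∧ e = 5) := by
  change (G.model m).Sat x (r.pre hm e) ↔ _
  have hD' : ∀ v : {u // G.alive u}, (G.model m).Sat (.inr v) r.drop ↔ D v.1 := fun v => hD v.1 v.2
  have hA' : ∀ v : {u // G.alive u}, (G.model m).Sat (.inr v) r.link ↔ A v.1 := fun v => hA v.1 v.2
  fin_cases e <;> rcases x with (_ | _ | s) | v <;>
    simp [Rule.pre, Model.Sat, sat_sortF, sat_spareF, sat_vertexF, LGraph.sort, hD', hA']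

/-- The worlds of an updated graph model and the worlds of the model of the rewritten graph. -/
def RewriteRel (G G' : LGraph U Λ) (u : U) :
    (WorldSort Λ ⊕ {u // G.alive u}) × Fin 6 → WorldSort Λ ⊕ {u // G'.alive u} → Prop
  | (.inl a, e), .inl b => a = b ∧ e ≠ 5
  | (.inl _, e), .inr v => e = 5 ∧ v.1 = u
  | (.inr v, _), .inr w => v.1 = w.1
  | (.inr _, _), .inl _ => False

/-- The new vertex is event 5 at a spare copy. Agent 0 links that copy to all vertices, so the
events alone decide the new adjacencies. For the other agents a spare copy sees no vertex, so the
new vertex sees only the hub and itself. -/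
theorem strongHom_rewrite (h : IsRewrite G G' D A u r.new) (hr : (G.model m).Sat (.inl none) r.cond)
    (hD : ∀ v (h : G.alive v), (G.model m).Sat (.inr ⟨v, h⟩) r.drop ↔ D v)
    (hA : ∀ v (h : G.alive v), (G.model m).Sat (.inr ⟨v, h⟩) r.link ↔ A v) :
    StrongHom ((G.model m).update (r.action hm)) (G'.model m)
      fun x y => RewriteRel G G' u x.1 y := by
  have hp := r.sat_pre (hm := hm) hD hA
  -- Five kinds of worlds, each with its event and its partner; this reduces the structure
  -- conditions to a finite case check.
  have view : ∀ (x : WorldSort Λ ⊕ {u // G.alive u}) (e : Fin 6) (y : WorldSort Λ ⊕ {u // G'.alive u}),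
      (G.model m).Sat x ((r.action hm).pre e) → RewriteRel G G' u (x, e) y →
      (x = .inl none ∧ e = 0 ∧ y = .inl none) ∨
      (x = .inl (some none) ∧ e = 1 ∧ y = .inl (some none)) ∨
      (∃ s, x = .inl (some (some s)) ∧ e = 2 ∧ y = .inl (some (some s))) ∨
      (∃ v hv hv', ¬ D v ∧ (e = 3 ∧ ¬ A v ∨ e = 4 ∧ A v) ∧
        x = .inr ⟨v, hv⟩ ∧ y = .inr ⟨v, hv'⟩) ∨
      (∃ hu, x = .inl (some (some r.new)) ∧ e = 5 ∧ y = .inr ⟨u, hu⟩) := by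
    intro x e y hx hxy
    rcases (hp x e).1 hx with ⟨rfl, rfl, -⟩ | ⟨rfl, rfl⟩ | ⟨⟨s, rfl⟩, rfl⟩ | ⟨v, rfl, hv, he⟩ | ⟨rfl, rfl⟩ <;>
      rcases y with b | w <;> simp [RewriteRel] at hxy ⊢
    · exact hxy.symm
    · exact hxy.symm
    · exact hxy.symm
    · exact ⟨hv, he, hxy.symm⟩
    · exact hxy
  refine ⟨?_, ?_, ?_, ?_, ?_⟩
  · rintro ⟨⟨x, e⟩, hx⟩
    rcases (hp x e).1 hx with ⟨rfl, rfl, -⟩ | ⟨rfl, rfl⟩ | ⟨⟨s, rfl⟩, rfl⟩ | ⟨v, rfl, hv, he⟩ | ⟨rfl, rfl⟩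
    · exact ⟨.inl none, by simp [RewriteRel]⟩
    · exact ⟨.inl (some none), by simp [RewriteRel]⟩
    · exact ⟨.inl (some (some s)), by simp [RewriteRel]⟩
    · exact ⟨.inr ⟨v.1, (h.alive _).2 (.inl ⟨v.2, hv⟩)⟩, by simp [RewriteRel]⟩
    · exact ⟨.inr ⟨u, (h.alive _).2 (.inr rfl)⟩, by simp [RewriteRel]⟩
  · rintro ((_ | _ | s) | ⟨v, hv⟩)
    · exact ⟨⟨(.inl none, (0 : Fin 6)), (hp _ _).2 (by simp [hr])⟩, by simp [RewriteRel]⟩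
    · exact ⟨⟨(.inl (some none), (1 : Fin 6)), (hp _ _).2 (by simp)⟩, by simp [RewriteRel]⟩
    · exact ⟨⟨(.inl (some (some s)), (2 : Fin 6)), (hp _ _).2 (by simp)⟩, by simp [RewriteRel]⟩
    · rcases (h.alive v).1 hv with ⟨hv', hd⟩ | rfl
      · by_cases ha : A v
        · exact ⟨⟨(.inr ⟨v, hv'⟩, (4 : Fin 6)), (hp _ _).2 (by simp [hd, ha])⟩, by simp [RewriteRel]⟩
        · exact ⟨⟨(.inr ⟨v, hv'⟩, (3 : Fin 6)), (hp _ _).2 (by simp [hd, ha])⟩, by simp [RewriteRel]⟩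
      · exact ⟨⟨(.inl (some (some r.new)), (5 : Fin 6)), (hp _ _).2 (by simp)⟩, by simp [RewriteRel]⟩
  · rintro i ⟨⟨x, e⟩, hx⟩ ⟨⟨y, f⟩, hy⟩ x' y' hx' hy'
    refine (and_congr Iff.rfl (r.link_action hm i _ _ _)).trans ?_
    have hx2 := view x e x' hx hx'
    have hy2 := view y f y' hy hy'
    change (if i.1 = 0 then G.rel₀ x y else G.rel₁ x y) ∧
      (blockQ i e = blockQ i f ∨ blockQstar i e = blockQstar i f) ↔
      if i.1 = 0 then G'.rel₀ x' y' else G'.rel₁ x' y'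
    clear hx hy hx' hy' hp view hD hA
    have fresh' : ∀ v, G.alive v → ¬ D v → u ≠ v := fun v h1 h2 => (h.fresh v h1 h2).symm
    by_cases hi : i.1 = 0 <;> simp only [hi, if_true, if_false, blockQ, blockQstar]
    all_goals
      rcases hx2 with ⟨rfl, rfl, rfl⟩ | ⟨rfl, rfl, rfl⟩ | ⟨s, rfl, rfl, rfl⟩ |
        ⟨v, hv, hv', hd, ⟨rfl, ha⟩ | ⟨rfl, ha⟩, rfl, rfl⟩ | ⟨hu, rfl, rfl, rfl⟩ <;>
      rcases hy2 with ⟨rfl, rfl, rfl⟩ | ⟨rfl, rfl, rfl⟩ | ⟨t, rfl, rfl, rfl⟩ |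
        ⟨w, hw, hw', hdw, ⟨rfl, haw⟩ | ⟨rfl, haw⟩, rfl, rfl⟩ | ⟨hu', rfl, rfl, rfl⟩ <;>
      simp_all [LGraph.rel₀, LGraph.rel₁, IsLabel, h.adj_new, h.adj_old, h.adj_left, h.adj_right, h.fresh]
  · rintro p ⟨⟨x, e⟩, hx⟩ y hxy
    change (sortEquiv Λ (G.sort x) : ℕ) = p ↔ (sortEquiv Λ (G'.sort y) : ℕ) = p
    rcases view x e y hx hxy with ⟨rfl, rfl, rfl⟩ | ⟨rfl, rfl, rfl⟩ | ⟨s, rfl, rfl, rfl⟩ |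
        ⟨v, hv, hv', hd, -, rfl, rfl⟩ | ⟨hu, rfl, rfl, rfl⟩
    · rfl
    · rfl
    · rfl
    · simp only [LGraph.sort, h.lab_old v hv hd]
    · simp only [LGraph.sort, h.lab_new]
  · intro i x y hxy
    rfl

end Rules

/-! ### Tape configurations as graphs, and formulas that read them -/

section Configurations

/-- Labels of cells, with their position modulo 3 and their content, and labels of heads, with their
state and the scanned symbol. -/
abbrev TapeLabel (Γ Q : Type) : Type := (ZMod 3 × Γ) ⊕ (Q × Γ)

/-- A finite part `[lo, hi)` of a tape, possibly with a head: its position, its state, and the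
symbol that replaces the content of the cell at this position. -/
structure Config (Γ Q : Type) : Type where
  lo : ℤ
  hi : ℤ
  tape : ℤ → Γ
  head : Option (ℤ × Q × Γ)

variable {Γ Q : Type} [Inhabited Γ]

/-- The graph of a configuration: a path of cells, and a head that is adjacent to one cell. -/
def Config.graph (c : Config Γ Q) : LGraph (Option ℤ) (TapeLabel Γ Q) where
  alive
    | none => ∃ x, c.head = some x
    | some i => c.lo ≤ i ∧ i < c.hi
  lab
    | none => match c.head with
      | some x => .inr x.2
      | none => .inl (0, default)
    | some i => .inl (i, c.tape i)
  adj
    | none, none => True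
    | none, some i => ∃ x, c.head = some (i, x)
    | some i, none => ∃ x, c.head = some (i, x)
    | some i, some j => i = j ∨ i = j + 1 ∨ j = i + 1

section

variable {c : Config Γ Q} {i j : ℤ}

@[simp] theorem Config.alive_none : c.graph.alive none ↔ ∃ x, c.head = some x := Iff.rfl

@[simp] theorem Config.alive_some : c.graph.alive (some i) ↔ c.lo ≤ i ∧ i < c.hi := Iff.rfl

@[simp] theorem Config.lab_some : c.graph.lab (some i) = .inl (i, c.tape i) := rfl

theorem Config.lab_none {x : ℤ × Q × Γ} (h : c.head = some x) : c.graph.lab none = .inr x.2 := by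
  simp [Config.graph, h]

@[simp] theorem Config.adj_none_none : c.graph.adj none none ↔ True := Iff.rfl

@[simp] theorem Config.adj_none_some : c.graph.adj none (some i) ↔ ∃ x, c.head = some (i, x) :=
  Iff.rfl

@[simp] theorem Config.adj_some_none : c.graph.adj (some i) none ↔ ∃ x, c.head = some (i, x) :=
  Iff.rfl

@[simp] theorem Config.adj_some_some :
    c.graph.adj (some i) (some j) ↔ i = j ∨ i = j + 1 ∨ j = i + 1 := Iff.rfl

end

variable {m N : ℕ}

variable [Finite Γ] [Finite Q]

variable (Γ Q) in
/-- The vertex is a cell at a position that is `r` modulo 3. -/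
noncomputable def resF (r : ZMod 3) : Formula m N :=
  labF fun x : TapeLabel Γ Q => ∃ b, x = .inl (r, b)

variable (Q) in
/-- The vertex is a cell with content `b`. -/
noncomputable def symF (b : Γ) : Formula m N := labF fun x : TapeLabel Γ Q => ∃ r, x = .inl (r, b)

variable (Γ Q) in
/-- The vertex is a cell. -/
noncomputable def cellF : Formula m N := labF fun x : TapeLabel Γ Q => ∃ y, x = .inl y

variable (Γ Q) in
/-- The vertex is a head. -/
noncomputable def headF : Formula m N := labF fun x : TapeLabel Γ Q => ∃ y, x = .inr y

/-- The vertex is adjacent to a head with the given state and symbol. -/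
noncomputable def scannedF (hm : 2 ≤ m) (q : Q) (a : Γ) : Formula m N :=
  nearF (TapeLabel Γ Q) hm (labF fun x : TapeLabel Γ Q => x = .inr (q, a))

variable (Γ Q) in
/-- The vertex is the cell at some position `i`, and the formula is satisfied by the cell at the
position `i + d`, for `d = ± 1`. -/
noncomputable def shiftF (hm : 2 ≤ m) (d : ℤ) (φ : Formula m N) : Formula m N :=
  disj (.and (resF Γ Q 0) (nearF (TapeLabel Γ Q) hm (.and (resF Γ Q (0 + d)) φ)))
    (disj (.and (resF Γ Q 1) (nearF (TapeLabel Γ Q) hm (.and (resF Γ Q (1 + d)) φ)))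
      (.and (resF Γ Q 2) (nearF (TapeLabel Γ Q) hm (.and (resF Γ Q (2 + d)) φ))))

variable {hm : 2 ≤ m} {c : Config Γ Q} {i : ℤ} {h : c.graph.alive (some i)}
  {h₀ : c.graph.alive none}

theorem sat_resF {r : ZMod 3} :
    (c.graph.model m).Sat (.inr ⟨some i, h⟩) (resF Γ Q r : Formula m N) ↔ (i : ZMod 3) = r := by
  simp [resF, sat_labF]

theorem sat_resF_none {r : ZMod 3} :
    ¬ (c.graph.model m).Sat (.inr ⟨none, h₀⟩) (resF Γ Q r : Formula m N) := by
  obtain ⟨x, hx⟩ := h₀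
  simp [resF, sat_labF, Config.lab_none hx]

theorem sat_symF {b : Γ} :
    (c.graph.model m).Sat (.inr ⟨some i, h⟩) (symF Q b : Formula m N) ↔ c.tape i = b := by
  simp [symF, sat_labF]

theorem sat_symF_none {b : Γ} :
    ¬ (c.graph.model m).Sat (.inr ⟨none, h₀⟩) (symF Q b : Formula m N) := by
  obtain ⟨x, hx⟩ := h₀
  simp [symF, sat_labF, Config.lab_none hx]

theorem sat_cellF : (c.graph.model m).Sat (.inr ⟨some i, h⟩) (cellF Γ Q : Formula m N) := by
  simp [cellF, sat_labF]

theorem sat_cellF_none : ¬ (c.graph.model m).Sat (.inr ⟨none, h₀⟩) (cellF Γ Q : Formula m N) := by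
  obtain ⟨x, hx⟩ := h₀
  simp [cellF, sat_labF, Config.lab_none hx]

theorem sat_labF_head {q : Q} {a : Γ} {v : Option ℤ} {h : c.graph.alive v} :
    (c.graph.model m).Sat (.inr ⟨v, h⟩)
      (labF fun x : TapeLabel Γ Q => x = .inr (q, a) : Formula m N) ↔
      v = none ∧ ∃ p, c.head = some (p, q, a) := by
  rw [sat_labF]
  rcases v with _ | i
  · obtain ⟨⟨p, x⟩, hx⟩ := h
    simp [Config.lab_none hx, hx]
  · simp

theorem sat_some_headF :
    (c.graph.model m).Sat (.inl none) (someF (TapeLabel Γ Q) hm (headF Γ Q) : Formula m N) ↔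
      ∃ x, c.head = some x := by
  rw [sat_someF]
  constructor
  · rintro ⟨_ | i, h, h'⟩
    · exact h
    · simp [headF, sat_labF] at h'
  · rintro ⟨x, hx⟩
    exact ⟨none, ⟨x, hx⟩, (sat_labF _).2 ⟨x.2, Config.lab_none hx⟩⟩

theorem sat_scannedF {q : Q} {a : Γ} :
    (c.graph.model m).Sat (.inr ⟨some i, h⟩) (scannedF hm q a : Formula m N) ↔
      c.head = some (i, q, a) := by
  rw [scannedF, sat_nearF]
  simp only [sat_labF_head]
  constructor
  · rintro ⟨_, -, h1, rfl, p, h2⟩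
    obtain ⟨x, h1⟩ := Config.adj_some_none.1 h1
    rw [h2] at h1 ⊢
    simp only [Option.some.injEq, Prod.mk.injEq] at h1 ⊢
    exact ⟨h1.1, trivial⟩
  · intro h'
    exact ⟨none, ⟨_, h'⟩, Config.adj_some_none.2 ⟨_, h'⟩, rfl, _, h'⟩

theorem zmod_three_cases (r : ZMod 3) : r = 0 ∨ r = 1 ∨ r = 2 := by
  revert r; decide

/-- The positions `i - 1`, `i`, `i + 1` are distinct modulo 3, so the residue singles out one of the
adjacent cells. -/
theorem sat_shiftF {d : ℤ} (hd : d = 1 ∨ d = -1) {φ : Formula m N} :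
    (c.graph.model m).Sat (.inr ⟨some i, h⟩) (shiftF Γ Q hm d φ) ↔
      ∃ h', (c.graph.model m).Sat (.inr ⟨some (i + d), h'⟩) φ := by
  have key : ∀ r : ZMod 3, (c.graph.model m).Sat (.inr ⟨some i, h⟩)
      (.and (resF Γ Q r) (nearF (TapeLabel Γ Q) hm (.and (resF Γ Q (r + d)) φ))) ↔
      (i : ZMod 3) = r ∧ ∃ h', (c.graph.model m).Sat (.inr ⟨some (i + d), h'⟩) φ := by
    intro r
    simp only [Model.Sat, sat_resF, sat_nearF]
    refine and_congr_right fun hr => ⟨?_, ?_⟩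
    · rintro ⟨_ | j, hj, h1, h2, h3⟩
      · exact absurd h2 sat_resF_none
      · rw [sat_resF, ← hr] at h2
        -- The difference is a multiple of 3, and adjacency bounds it by 2 in absolute value.
        have h4 : j = i + d := by
          have h5 : ((j - (i + d) : ℤ) : ZMod 3) = 0 := by push_cast; rw [h2]; ring
          rw [ZMod.intCast_zmod_eq_zero_iff_dvd] at h5
          have h1' : i = j ∨ i = j + 1 ∨ j = i + 1 := h1
          omega
        subst h4
        exact ⟨hj, h3⟩
    · rintro ⟨h', h3⟩
      refine ⟨some (i + d), h', ?_, ?_, h3⟩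
      · change i = i + d ∨ i = i + d + 1 ∨ i + d = i + 1
        omega
      · rw [sat_resF, ← hr]; push_cast; rfl
  rw [shiftF, sat_disj, sat_disj, key, key, key]
  have := zmod_three_cases (i : ZMod 3)
  tauto

variable (Q) in
/-- The tape consists, to the right of the cell, of the symbols in the list. -/
noncomputable def contentF (hm : 2 ≤ m) : List Γ → Formula m N
  | [] => .neg (shiftF Γ Q hm 1 .top)
  | b :: l => shiftF Γ Q hm 1 (.and (symF Q b) (contentF hm l))

theorem sat_contentF {l : List Γ} : ∀ {i : ℤ} {h : c.graph.alive (some i)},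
    (c.graph.model m).Sat (.inr ⟨some i, h⟩) (contentF Q hm l : Formula m N) ↔
      i + 1 + l.length = c.hi ∧ ∀ j : ℕ, ∀ h : j < l.length, c.tape (i + 1 + j) = l[j] := by
  induction l with
  | nil =>
    intro i h
    simp only [contentF, Model.Sat, sat_shiftF (Or.inl rfl)]
    simp only [exists_prop, and_true, Config.graph]
    have h' : c.lo ≤ i ∧ i < c.hi := h
    simp only [List.length_nil, not_lt_zero, IsEmpty.forall_iff, implies_true, and_true]
    push_cast
    omega
  | cons b l ih =>
    intro i h
    simp only [contentF, sat_shiftF (Or.inl rfl), Model.Sat, sat_symF, ih]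
    constructor
    · rintro ⟨_, h1, h2, h3⟩
      refine ⟨by push_cast [List.length_cons]; omega, ?_⟩
      rintro (_ | j) hj
      · simpa using h1
      · rw [List.getElem_cons_succ, ← h3 j (by simpa using hj)]
        congr 1; push_cast; ring
    · rintro ⟨h1, h2⟩
      have h' : c.lo ≤ i ∧ i < c.hi := h
      push_cast [List.length_cons] at h1
      refine ⟨⟨by omega, by omega⟩, ?_, by omega, ?_⟩
      · have := h2 0 (by simp)
        rw [List.getElem_cons_zero] at this
        simpa using this
      intro j hj
      have := h2 (j + 1) (by simpa using hj)
      rw [List.getElem_cons_succ] at this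
      rw [← this]
      congr 1; push_cast; ring

end Configurations

/-! ### Rewriting a cell or the head -/

section CellRewriting

variable {Γ Q : Type} [Inhabited Γ] {c : Config Γ Q}

theorem exists_vertex {P : ∀ v, c.graph.alive v → Prop} (hP : ∀ h, ¬ P none h) :
    (∃ v, ∃ h, P v h) ↔ ∃ i, ∃ h, P (some i) h := by
  constructor
  · rintro ⟨_ | i, h, h'⟩
    · exact absurd h' (hP h)
    · exact ⟨i, h, h'⟩
  · rintro ⟨i, h, h'⟩; exact ⟨_, h, h'⟩

/-- Adding a cell at `k`, or replacing the cell at `k`. -/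
theorem isRewrite_cell {c' : Config Γ Q} {D A : Option ℤ → Prop} {x : TapeLabel Γ Q} (k : ℤ)
    (hh : c'.head = c.head) (ht : ∀ i, i ≠ k → c'.tape i = c.tape i) (hx : x = .inl (k, c'.tape k))
    (hc : ∀ i, c'.lo ≤ i ∧ i < c'.hi ↔ (c.lo ≤ i ∧ i < c.hi) ∨ i = k)
    (hD : ¬ D none) (hD' : ∀ i, c.lo ≤ i ∧ i < c.hi → (D (some i) ↔ i = k))
    (hA : ∀ y, c.head = some y → (A none ↔ y.1 = k))
    (hA' : ∀ i, c.lo ≤ i ∧ i < c.hi → i ≠ k → (A (some i) ↔ i = k + 1 ∨ k = i + 1)) :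
    IsRewrite c.graph c'.graph D A (some k) x := by
  subst hx
  -- An existing cell at `k` is dropped, so the name `k` is free both when a cell is added and when
  -- one is replaced.
  have aux : ∀ i, c.graph.alive (some i) → ¬ D (some i) → i ≠ k := fun i h h' hk =>
    h' ((hD' i h).2 hk)
  refine ⟨?_, ?_, ?_, ?_, ?_, ?_, ?_, ?_⟩
  · rintro (_ | i)
    · simp [hh, hD]
    · rw [Config.alive_some, hc, Config.alive_some, Option.some.injEq]
      by_cases hk : i = k
      · simp [hk]
      · simp only [hk, or_false]
        exact ⟨fun h => ⟨h, fun h' => hk ((hD' i h).1 h')⟩, fun h => h.1⟩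
  · rintro (_ | i) h h'
    · simp
    · simpa using aux i h h'
  · rfl
  · rintro (_ | i) h h'
    · obtain ⟨y, hy⟩ := h
      rw [Config.lab_none hy, Config.lab_none (hh.trans hy)]
    · rw [Config.lab_some, Config.lab_some, ht i (aux i h h')]
  · rintro (_ | i) (_ | j) <;> simp [hh]
  · simp
  · rintro (_ | i) h h'
    · obtain ⟨y, hy⟩ := h
      rw [hA y hy, Config.adj_some_none, hh, hy]
      simp [Prod.ext_iff]
    · have := aux i h h'
      rw [hA' i h this, Config.adj_some_some]
      omega
  · rintro (_ | i) h h'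
    · obtain ⟨y, hy⟩ := h
      rw [hA y hy, Config.adj_none_some, hh, hy]
      simp [Prod.ext_iff]
    · have := aux i h h'
      rw [hA' i h this, Config.adj_some_some]
      omega

/-- Replacing the head. -/
theorem isRewrite_head {p' : ℤ} {q' : Q} {a' : Γ} {A : Option ℤ → Prop}
    (hA : ∀ i, c.lo ≤ i → i < c.hi → (A (some i) ↔ i = p')) :
    IsRewrite c.graph { c with head := some (p', q', a') : Config Γ Q }.graph (fun v => v = none)
      A none (.inr (q', a')) := by
  refine ⟨?_, ?_, ?_, ?_, ?_, ?_, ?_, ?_⟩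
  · rintro (_ | i) <;> simp
  · rintro (_ | i) h h'
    · exact absurd rfl h'
    · simp
  · rw [Config.lab_none rfl]
  · rintro (_ | i) h h'
    · exact absurd rfl h'
    · simp
  · rintro (_ | i) (_ | j) h h₁ h' h₂
    · simp
    · exact absurd rfl h₁
    · exact absurd rfl h₂
    · simp
  · simp
  · rintro (_ | i) h h'
    · exact absurd rfl h'
    · rw [hA i h.1 h.2]; simp [eq_comm]
  · rintro (_ | i) h h'
    · exact absurd rfl h'
    · rw [hA i h.1 h.2]; simp [eq_comm]

end CellRewriting

/-! ### The rules of the simulation and their effects -/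

section TapeRules

/-- The rule turns the first graph into the second. -/
def Rule.Step {m N : ℕ} {U Λ : Type} [Finite Λ] (r : Rule m N Λ) (G G' : LGraph U Λ) : Prop :=
  (G.model m).Sat (.inl none) r.cond ∧ ∃ D A u, IsRewrite G G' D A u r.new ∧
    (∀ v (h : G.alive v), (G.model m).Sat (.inr ⟨v, h⟩) r.drop ↔ D v) ∧
    ∀ v (h : G.alive v), (G.model m).Sat (.inr ⟨v, h⟩) r.link ↔ A v

variable {Γ Q : Type} [Inhabited Γ] {m N : ℕ} [Finite Γ] [Finite Q]

/-- Falsity. -/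
def botF : Formula m N := .neg .top

variable (Γ Q) in
/-- Create the first cell. -/
noncomputable def firstRule (hm : 2 ≤ m) : Rule m N (TapeLabel Γ Q) where
  cond := .neg (someF (TapeLabel Γ Q) hm .top)
  drop := botF
  link := botF
  new := .inl (0, default)

variable (Q) in
/-- Append a cell with content `a` while there is no head. -/
noncomputable def appendRule (hm : 2 ≤ m) (r : ZMod 3) (a : Γ) : Rule m N (TapeLabel Γ Q) where
  cond := .and (.neg (someF (TapeLabel Γ Q) hm (headF Γ Q)))
    (someF (TapeLabel Γ Q) hm (.and (resF Γ Q r) (.neg (shiftF Γ Q hm 1 .top))))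
  drop := botF
  link := .and (resF Γ Q r) (.neg (shiftF Γ Q hm 1 .top))
  new := .inl (r + 1, a)

/-- Put a head on the first cell if the other cells hold `l`. -/
noncomputable def startRule (hm : 2 ≤ m) (q : Q) (a : Γ) (l : List Γ) :
    Rule m N (TapeLabel Γ Q) where
  cond := .and (.neg (someF (TapeLabel Γ Q) hm (headF Γ Q)))
    (someF (TapeLabel Γ Q) hm
      -- The content of the first cell is not tested, because the symbol `a` of the head will
      -- replace it.
      (.and (.and (cellF Γ Q) (.neg (shiftF Γ Q hm (-1) .top))) (contentF Q hm l)))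
  drop := botF
  link := .and (cellF Γ Q) (.neg (shiftF Γ Q hm (-1) .top))
  new := .inr (q, a)

/-- Change state and scanned symbol. -/
noncomputable def writeRule (hm : 2 ≤ m) (q : Q) (a : Γ) (q' : Q) (a' : Γ) :
    Rule m N (TapeLabel Γ Q) where
  cond := someF (TapeLabel Γ Q) hm (labF fun x : TapeLabel Γ Q => x = .inr (q, a))
  drop := labF fun x : TapeLabel Γ Q => x = .inr (q, a)
  -- The old head is adjacent to itself; `cellF` leaves only the scanned cell.
  link := .and (cellF Γ Q) (scannedF hm q a)
  new := .inr (q', a')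

/-- Move the head by `d = ± 1` to a cell with content `b`. -/
noncomputable def moveRule (hm : 2 ≤ m) (d : ℤ) (q : Q) (a : Γ) (q' : Q) (b : Γ) :
    Rule m N (TapeLabel Γ Q) where
  cond := someF (TapeLabel Γ Q) hm
    -- The old head is dropped, so the cell left behind must already hold its symbol `a`.
    (.and (symF Q b) (shiftF Γ Q hm (-d) (.and (symF Q a) (scannedF hm q a))))
  drop := labF fun x : TapeLabel Γ Q => x = .inr (q, a)
  link := .and (symF Q b) (shiftF Γ Q hm (-d) (.and (symF Q a) (scannedF hm q a)))
  new := .inr (q', b)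

/-- Copy the scanned symbol from the head into the scanned cell. -/
noncomputable def storeRule (hm : 2 ≤ m) (q : Q) (a : Γ) (r : ZMod 3) :
    Rule m N (TapeLabel Γ Q) where
  cond := someF (TapeLabel Γ Q) hm (.and (resF Γ Q r) (scannedF hm q a))
  drop := .and (resF Γ Q r) (scannedF hm q a)
  -- The replacement inherits the neighbours of the dropped cell, the head among them.
  link := nearF (TapeLabel Γ Q) hm (.and (resF Γ Q r) (scannedF hm q a))
  new := .inl (r, a)

/-- Append a blank cell in direction `d = ± 1` of the head at the end of the tape. -/
noncomputable def extendRule (hm : 2 ≤ m) (d : ℤ) (q : Q) (a : Γ) (r : ZMod 3) :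
    Rule m N (TapeLabel Γ Q) where
  cond := someF (TapeLabel Γ Q) hm
    (.and (resF Γ Q r) (.and (scannedF hm q a) (.neg (shiftF Γ Q hm d .top))))
  drop := botF
  link := .and (resF Γ Q r) (.and (scannedF hm q a) (.neg (shiftF Γ Q hm d .top)))
  new := .inl (r + d, default)

variable {hm : 2 ≤ m} {c : Config Γ Q} {p : ℤ} {q q' : Q} {a a' b : Γ} {r : ZMod 3} {d : ℤ} {l : List Γ}

theorem not_sat_botF {W : Type} {M : Model m W} {w : W} : ¬ M.Sat w (botF : Formula m N) :=
  fun h => h trivial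

/-- For each rule, a lemma of this kind extracts from the condition what the matching `step_` lemma
needs and the invariant does not supply. -/
theorem sat_first_cond (h : (c.graph.model m).Sat (.inl none) (firstRule Γ Q hm : Rule m N _).cond) :
    c.head = none ∧ c.hi ≤ c.lo := by
  simp only [firstRule, Model.Sat, sat_someF] at h
  constructor
  · cases hc : c.head with
    | none => rfl
    | some x => exact absurd ⟨none, ⟨x, hc⟩, trivial⟩ h
  · by_contra hl
    exact h ⟨some c.lo, ⟨le_rfl, by omega⟩, trivial⟩

theorem step_first (h₀ : c.head = none) (hlo : c.lo = 0) (hhi : c.hi = 0)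
    (ht : c.tape 0 = default) :
    (firstRule Γ Q hm : Rule m N _).Step c.graph { c with hi := 1 : Config Γ Q }.graph := by
  refine ⟨?_, fun _ => False, fun _ => False, some 0, isRewrite_cell 0 rfl (fun _ _ => rfl) ?_ ?_
    not_false ?_ ?_ ?_, ?_, ?_⟩
  · simp only [firstRule, Model.Sat, sat_someF]
    rintro ⟨_ | i, h, -⟩
    · simp [h₀] at h
    · have : c.lo ≤ i ∧ i < c.hi := h
      omega
  · simp [firstRule, ht]
  · intro i
    simp only [hlo, hhi]
    omega
  · intro i hi; omega
  · simp [h₀]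
  · intro i hi; omega
  · intro v h; simp [firstRule, not_sat_botF]
  · intro v h; simp [firstRule, not_sat_botF]

theorem sat_last (h : c.graph.alive (some p)) :
    (c.graph.model m).Sat (.inr ⟨some p, h⟩)
      (.and (resF Γ Q r) (.neg (shiftF Γ Q hm 1 .top)) : Formula m N) ↔
      p = c.hi - 1 ∧ (p : ZMod 3) = r := by
  have h' : c.lo ≤ p ∧ p < c.hi := h
  simp only [Model.Sat, sat_resF, sat_shiftF (Or.inl rfl), exists_prop, and_true, Config.alive_some]
  rw [and_comm]
  refine and_congr_left fun _ => ?_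
  omega

theorem sat_append_cond
    (h : (c.graph.model m).Sat (.inl none) (appendRule Q hm r a : Rule m N _).cond) :
    c.head = none ∧ c.lo < c.hi ∧ r = (c.hi - 1 : ℤ) := by
  simp only [appendRule, Model.Sat.eq_6, Model.Sat.eq_5, sat_some_headF] at h
  obtain ⟨h1, h2⟩ := h
  refine ⟨by simpa [Option.eq_none_iff_forall_ne_some] using h1, ?_⟩
  rw [sat_someF, exists_vertex (fun h => by simp [Model.Sat, sat_resF_none])] at h2
  obtain ⟨i, h, h2⟩ := h2
  have h' : c.lo ≤ i ∧ i < c.hi := h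
  obtain ⟨rfl, h2⟩ := (sat_last h).1 h2
  exact ⟨by omega, h2.symm⟩

theorem step_append (h₀ : c.head = none) (hl : c.lo < c.hi) :
    (appendRule Q hm ((c.hi - 1 : ℤ) : ZMod 3) a : Rule m N _).Step c.graph
      { c with hi := c.hi + 1, tape := Function.update c.tape c.hi a : Config Γ Q }.graph := by
  have hA : ∀ v (h : c.graph.alive v), (c.graph.model m).Sat (.inr ⟨v, h⟩)
      (appendRule Q hm ((c.hi - 1 : ℤ) : ZMod 3) a : Rule m N _).link ↔ v = some (c.hi - 1) := by
    rintro (_ | i) h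
    · simp [h₀] at h
    · rw [appendRule, sat_last]
      simp +contextual
  refine ⟨?_, fun _ => False, fun v => v = some (c.hi - 1), some c.hi, isRewrite_cell c.hi rfl
    (fun i hi => Function.update_of_ne hi _ _) ?_ ?_ not_false ?_ ?_ ?_, ?_, hA⟩
  · simp only [appendRule, Model.Sat.eq_6, Model.Sat.eq_5, sat_some_headF]
    refine ⟨by simp [h₀], (sat_someF _).2 ⟨some (c.hi - 1), ⟨by omega, by omega⟩, (hA _ _).2 rfl⟩⟩
  · simp [appendRule]
  · intro i
    simp only
    omega
  · intro i hi
    simp only [false_iff]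
    omega
  · simp [h₀]
  · intro i hi hk
    simp only [Option.some.injEq]
    omega
  · intro v h; simp [appendRule, not_sat_botF]

theorem sat_leftmost (h : c.graph.alive (some p)) :
    (c.graph.model m).Sat (.inr ⟨some p, h⟩)
      (.and (cellF Γ Q) (.neg (shiftF Γ Q hm (-1) .top)) : Formula m N) ↔ p = c.lo := by
  have h' : c.lo ≤ p ∧ p < c.hi := h
  simp only [Model.Sat, sat_cellF, sat_shiftF (Or.inr rfl), exists_prop, and_true, true_and,
    Config.alive_some]
  omega

theorem sat_start_cond
    (h : (c.graph.model m).Sat (.inl none) (startRule hm q a l : Rule m N _).cond) :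
    c.head = none ∧ c.lo < c.hi ∧ c.lo + 1 + l.length = c.hi ∧
      ∀ j : ℕ, ∀ h : j < l.length, c.tape (c.lo + 1 + j) = l[j] := by
  simp only [startRule, Model.Sat.eq_6, Model.Sat.eq_5, sat_some_headF] at h
  obtain ⟨h1, h2⟩ := h
  refine ⟨by simpa [Option.eq_none_iff_forall_ne_some] using h1, ?_⟩
  rw [sat_someF, exists_vertex (fun h => by simp [Model.Sat, sat_cellF_none])] at h2
  obtain ⟨i, h, h2, h3⟩ := h2
  have h' : c.lo ≤ i ∧ i < c.hi := h
  obtain rfl := (sat_leftmost h).1 h2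
  exact ⟨h'.2, sat_contentF.1 h3⟩

theorem step_start (h₀ : c.head = none) (hl : c.lo < c.hi) (h₁ : c.lo + 1 + l.length = c.hi)
    (h₂ : ∀ j : ℕ, ∀ h : j < l.length, c.tape (c.lo + 1 + j) = l[j]) :
    (startRule hm q a l : Rule m N _).Step c.graph
      { c with head := some (c.lo, q, a) : Config Γ Q }.graph := by
  have hA : ∀ v (h : c.graph.alive v), (c.graph.model m).Sat (.inr ⟨v, h⟩)
      (startRule hm q a l : Rule m N _).link ↔ v = some c.lo := by
    rintro (_ | i) h
    · simp [h₀] at h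
    · rw [startRule, sat_leftmost]
      simp
  refine ⟨?_, fun _ => False, fun v => v = some c.lo, none,
    ⟨?_, ?_, ?_, ?_, ?_, ?_, ?_, ?_⟩, ?_, hA⟩
  · simp only [startRule, Model.Sat.eq_6, Model.Sat.eq_5, sat_some_headF]
    exact ⟨by simp [h₀], (sat_someF _).2 ⟨some c.lo, ⟨by omega, by omega⟩, (hA _ _).2 rfl,
      sat_contentF.2 ⟨h₁, h₂⟩⟩⟩
  · rintro (_ | i) <;> simp
  · rintro (_ | i) h -
    · simp [h₀] at h
    · simp
  · rw [Config.lab_none rfl]; rfl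
  · rintro (_ | i) h -
    · simp [h₀] at h
    · simp
  · rintro (_ | i) (_ | j) h - h' -
    · simp
    · simp [h₀] at h
    · simp [h₀] at h'
    · simp
  · simp
  · rintro (_ | i) h -
    · simp [h₀] at h
    · simp [eq_comm]
  · rintro (_ | i) h -
    · simp [h₀] at h
    · simp [eq_comm]
  · intro v h; simp [startRule, not_sat_botF]

theorem sat_write_cond
    (h : (c.graph.model m).Sat (.inl none) (writeRule hm q a q' a' : Rule m N _).cond) :
    ∃ p, c.head = some (p, q, a) := by
  simp only [writeRule, sat_someF, sat_labF_head] at h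
  obtain ⟨_, _, -, h⟩ := h
  exact h

theorem sat_drop_head (h₀ : c.head = some (p, q, a)) (v) (h : c.graph.alive v) :
    (c.graph.model m).Sat (.inr ⟨v, h⟩)
      (labF fun x : TapeLabel Γ Q => x = .inr (q, a) : Formula m N) ↔ v = none := by
  rw [sat_labF_head]; simp [h₀]

theorem step_write (h₀ : c.head = some (p, q, a)) :
    (writeRule hm q a q' a' : Rule m N _).Step c.graph
      { c with head := some (p, q', a') : Config Γ Q }.graph := by
  refine ⟨?_, fun v => v = none, fun v => v = some p, none,
    isRewrite_head fun i _ _ => by simp, sat_drop_head h₀, ?_⟩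
  · exact (sat_someF _).2 ⟨none, ⟨_, h₀⟩, (sat_drop_head h₀ _ _).2 rfl⟩
  · rintro (_ | i) h
    · simp [writeRule, Model.Sat, sat_cellF_none]
    · simp [writeRule, Model.Sat, sat_cellF, sat_scannedF, h₀, eq_comm]

theorem sat_move_link (hd : d = 1 ∨ d = -1) {i : ℤ} (h : c.graph.alive (some i)) :
    (c.graph.model m).Sat (.inr ⟨some i, h⟩) (moveRule hm d q a q' b : Rule m N _).link ↔
      c.tape i = b ∧ (c.lo ≤ i - d ∧ i - d < c.hi) ∧ c.tape (i - d) = a ∧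
        c.head = some (i - d, q, a) := by
  have hd' : -d = 1 ∨ -d = -1 := by omega
  simp only [moveRule, Model.Sat, sat_symF, sat_shiftF hd', sat_scannedF, exists_prop,
    Config.alive_some, ← sub_eq_add_neg]

theorem sat_move_cond (hd : d = 1 ∨ d = -1)
    (h : (c.graph.model m).Sat (.inl none) (moveRule hm d q a q' b : Rule m N _).cond) :
    ∃ p, c.head = some (p, q, a) ∧ c.tape p = a ∧ c.tape (p + d) = b ∧
      c.lo ≤ p + d ∧ p + d < c.hi := by
  rw [moveRule, sat_someF, exists_vertex (fun h => by simp [Model.Sat, sat_symF_none])] at h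
  obtain ⟨i, h, h2⟩ := h
  obtain ⟨h3, h4, h5, h6⟩ := (sat_move_link (q' := q') hd h).1 h2
  exact ⟨i - d, h6, h5, by simpa using h3, by simpa using h⟩

theorem step_move (hd : d = 1 ∨ d = -1) (h₀ : c.head = some (p, q, a)) (h₁ : c.lo ≤ p)
    (h₂ : p < c.hi) (h₃ : c.lo ≤ p + d) (h₄ : p + d < c.hi) (h₅ : c.tape p = a)
    (h₆ : c.tape (p + d) = b) :
    (moveRule hm d q a q' b : Rule m N _).Step c.graph
      { c with head := some (p + d, q', b) : Config Γ Q }.graph := by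
  have hA : ∀ v (h : c.graph.alive v), (c.graph.model m).Sat (.inr ⟨v, h⟩)
      (moveRule hm d q a q' b : Rule m N _).link ↔ v = some (p + d) := by
    rintro (_ | i) h
    · simp [moveRule, Model.Sat, sat_symF_none]
    · rw [sat_move_link hd]
      simp only [h₀, Option.some.injEq, Prod.mk.injEq, and_true]
      constructor
      · rintro ⟨-, -, -, h⟩; omega
      · rintro rfl
        simp [h₁, h₂, h₅, h₆]
  exact ⟨(sat_someF _).2 ⟨some (p + d), ⟨h₃, h₄⟩, (hA _ _).2 rfl⟩, fun v => v = none,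
    fun v => v = some (p + d), none, isRewrite_head fun i _ _ => by simp, sat_drop_head h₀, hA⟩

theorem sat_store_cond
    (h : (c.graph.model m).Sat (.inl none) (storeRule hm q a r : Rule m N _).cond) :
    ∃ p : ℤ, c.head = some (p, q, a) ∧ r = p := by
  rw [storeRule, sat_someF, exists_vertex (fun h => by simp [Model.Sat, sat_resF_none])] at h
  obtain ⟨i, h, h2, h3⟩ := h
  exact ⟨i, sat_scannedF.1 h3, (sat_resF.1 h2).symm⟩

theorem step_store (h₀ : c.head = some (p, q, a)) (h₁ : c.lo ≤ p) (h₂ : p < c.hi) :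
    (storeRule hm q a (p : ZMod 3) : Rule m N _).Step c.graph
      { c with tape := Function.update c.tape p a : Config Γ Q }.graph := by
  have hD : ∀ v (h : c.graph.alive v), (c.graph.model m).Sat (.inr ⟨v, h⟩)
      (storeRule hm q a (p : ZMod 3) : Rule m N _).drop ↔ v = some p := by
    rintro (_ | i) h
    · simp [storeRule, Model.Sat, sat_resF_none]
    · simp only [storeRule, Model.Sat, sat_resF, sat_scannedF, h₀, Option.some.injEq,
        Prod.mk.injEq, and_true]
      constructor
      · rintro ⟨-, rfl⟩; rfl
      · rintro rfl; exact ⟨rfl, rfl⟩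
  refine ⟨(sat_someF _).2 ⟨some p, ⟨h₁, h₂⟩, (hD _ _).2 rfl⟩, fun v => v = some p,
    fun v => c.graph.adj v (some p), some p, isRewrite_cell p rfl
    (fun i hi => Function.update_of_ne hi _ _) ?_ ?_ ?_ ?_ ?_ ?_, hD, ?_⟩
  · simp [storeRule]
  · intro i
    simp only
    omega
  · simp
  · simp
  · simp [h₀, Prod.ext_iff]
  · intro i hi hk
    rw [Config.adj_some_some]
    omega
  · intro v h
    rw [storeRule, sat_nearF]
    constructor
    · rintro ⟨w, h, h1, h2⟩
      exact (hD w h).1 h2 ▸ h1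
    · intro h1
      exact ⟨some p, ⟨h₁, h₂⟩, h1, (hD _ _).2 rfl⟩

theorem sat_extend_link (hd : d = 1 ∨ d = -1) {i : ℤ} (h : c.graph.alive (some i)) :
    (c.graph.model m).Sat (.inr ⟨some i, h⟩) (extendRule hm d q a r : Rule m N _).link ↔
      (i : ZMod 3) = r ∧ c.head = some (i, q, a) ∧ ¬ (c.lo ≤ i + d ∧ i + d < c.hi) := by
  simp only [extendRule, Model.Sat, sat_resF, sat_shiftF hd, sat_scannedF, exists_prop, and_true,
    Config.alive_some]

theorem sat_extend_cond (hd : d = 1 ∨ d = -1)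
    (h : (c.graph.model m).Sat (.inl none) (extendRule hm d q a r : Rule m N _).cond) :
    ∃ p : ℤ, c.head = some (p, q, a) ∧ r = p ∧ c.lo ≤ p ∧ p < c.hi ∧
      ¬ (c.lo ≤ p + d ∧ p + d < c.hi) := by
  rw [extendRule, sat_someF, exists_vertex (fun h => by simp [Model.Sat, sat_resF_none])] at h
  obtain ⟨i, h, h2⟩ := h
  obtain ⟨h3, h4, h5⟩ := (sat_extend_link hd h).1 h2
  exact ⟨i, h4, h3.symm, h.1, h.2, h5⟩

theorem step_extend (hd : d = 1 ∨ d = -1) (h₀ : c.head = some (p, q, a)) (h₁ : c.lo ≤ p)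
    (h₂ : p < c.hi) (h₃ : ¬ (c.lo ≤ p + d ∧ p + d < c.hi)) (h₄ : c.tape (p + d) = default) :
    (extendRule hm d q a (p : ZMod 3) : Rule m N _).Step c.graph
      { c with lo := min c.lo (p + d), hi := max c.hi (p + d + 1) : Config Γ Q }.graph := by
  have hA : ∀ v (h : c.graph.alive v), (c.graph.model m).Sat (.inr ⟨v, h⟩)
      (extendRule hm d q a (p : ZMod 3) : Rule m N _).link ↔ v = some p := by
    rintro (_ | i) h
    · simp [extendRule, Model.Sat, sat_resF_none]
    · rw [sat_extend_link hd]
      simp only [h₀, Option.some.injEq, Prod.mk.injEq, and_true]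
      constructor
      · rintro ⟨-, rfl, -⟩; rfl
      · rintro rfl; exact ⟨rfl, rfl, h₃⟩
  refine ⟨(sat_someF _).2 ⟨some p, ⟨h₁, h₂⟩, (hA _ _).2 rfl⟩, fun _ => False,
    fun v => v = some p, some (p + d), isRewrite_cell (p + d) rfl (fun _ _ => rfl) ?_ ?_ not_false
    ?_ ?_ ?_, ?_, hA⟩
  · simp [extendRule, h₄]
  · intro i
    simp only
    omega
  · intro i hi
    simp only [false_iff]
    omega
  · intro y hy
    rw [h₀, Option.some.injEq] at hy
    subst hy
    simp only [reduceCtorEq, false_iff]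
    omega
  · intro i hi hk
    simp only [Option.some.injEq]
    omega
  · intro v h; simp [extendRule, not_sat_botF]

end TapeRules

/-! ### Configurations that represent machine configurations -/

section Representation

/-- The displacement of the head. -/
def dirInt : Dir → ℤ
  | .left => -1
  | .right => 1

instance : Finite Dir :=
  Finite.of_surjective (fun b : Bool => bif b then Dir.left else Dir.right) fun d => by
    cases d
    · exact ⟨true, rfl⟩
    · exact ⟨false, rfl⟩

theorem dirInt_cases (d : Dir) : dirInt d = 1 ∨ dirInt d = -1 := by
  cases d <;> simp [dirInt]

theorem move_nth {Γ : Type} [Inhabited Γ] (T : Tape Γ) (d : Dir) (i : ℤ) :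
    (T.move d).nth i = T.nth (i + dirInt d) := by
  cases d <;> simp [dirInt, sub_eq_add_neg]

variable {Γ Q : Type} [Inhabited Γ]

/-- The configuration represents the state and the tape of the machine. -/
def Config.Represents (c : Config Γ Q) (q : Q) (T : Tape Γ) : Prop :=
  ∃ p a, c.head = some (p, q, a) ∧ c.lo ≤ p ∧ p < c.hi ∧
    (∀ i, ¬ (c.lo ≤ i ∧ i < c.hi) → c.tape i = default) ∧
    ∀ k, T.nth k = Function.update c.tape p a (p + k)

theorem mk₁_nth_neg {Γ : Type} [Inhabited Γ] (l : List Γ) {k : ℤ} (hk : k < 0) :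
    (Tape.mk₁ l).nth k = default := by
  obtain ⟨n, rfl⟩ : ∃ n : ℕ, k = -(n + 1 : ℕ) := ⟨(-k - 1).toNat, by omega⟩
  change (ListBlank.mk []).nth n = default
  rw [ListBlank.nth_mk]
  simp

theorem mk₁_nth_natCast {Γ : Type} [Inhabited Γ] (l : List Γ) (n : ℕ) :
    (Tape.mk₁ l).nth n = l.getI n := by
  rw [Tape.mk₁, Tape.mk₂, Tape.mk'_nth_nat, ListBlank.nth_mk]

/-- The symbol of the head overrides the first cell, so the tape reads `a :: l`, with blanks
elsewhere. -/
theorem represents_init {c : Config Γ Q} {q : Q} {a : Γ} {l : List Γ} (hlo : c.lo = 0)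
    (ht : ∀ i, ¬ (c.lo ≤ i ∧ i < c.hi) → c.tape i = default)
    (h₁ : c.lo + 1 + l.length = c.hi)
    (h₂ : ∀ j : ℕ, ∀ h : j < l.length, c.tape (c.lo + 1 + j) = l[j]) :
    Config.Represents { c with head := some (c.lo, q, a) } q (Tape.mk₁ (a :: l)) := by
  refine ⟨c.lo, a, rfl, le_rfl, ?_, ht, fun k => ?_⟩
  · change c.lo < c.hi
    omega
  · change _ = Function.update c.tape c.lo a (c.lo + k)
    rcases lt_trichotomy k 0 with hk | rfl | hk
    · rw [mk₁_nth_neg _ hk, Function.update_of_ne (by omega), ht _ (by omega)]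
    · have := mk₁_nth_natCast (a :: l) 0
      simpa using this
    · obtain ⟨n, rfl⟩ : ∃ n : ℕ, k = (n + 1 : ℕ) := ⟨(k - 1).toNat, by omega⟩
      rw [mk₁_nth_natCast, Function.update_of_ne (by omega), List.getI_cons_succ]
      rcases lt_or_ge n l.length with hn | hn
      · rw [List.getI_eq_getElem _ hn, ← h₂ n hn]
        congr 1; push_cast; ring
      · rw [List.getI_eq_default _ hn, ht _ (by omega)]

theorem Config.Represents.write {c : Config Γ Q} {p : ℤ} {q q' : Q} {a a' : Γ} {T : Tape Γ}
    (h : c.Represents q T) (hc : c.head = some (p, q, a)) :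
    Config.Represents { c with head := some (p, q', a') } q' (T.write a') := by
  obtain ⟨p', b, h1, h2, h3, h4, h5⟩ := h
  rw [hc] at h1
  simp only [Option.some.injEq, Prod.mk.injEq, true_and] at h1
  obtain ⟨rfl, rfl⟩ := h1
  refine ⟨p, a', rfl, h2, h3, h4, fun k => ?_⟩
  rw [Tape.write_nth, h5]
  by_cases hk : k = 0
  · simp [hk]
  · rw [if_neg hk, Function.update_of_ne (by omega), Function.update_of_ne (by omega)]

/-- The head agrees with its cell before and after the move, so it overrides nothing, and moving is
a shift of coordinates. -/
theorem Config.Represents.move {c : Config Γ Q} {p : ℤ} {q q' : Q} {a : Γ} {T : Tape Γ} {d : Dir}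
    (h : c.Represents q T) (hc : c.head = some (p, q, a)) (ha : c.tape p = a)
    (h₁ : c.lo ≤ p + dirInt d) (h₂ : p + dirInt d < c.hi) :
    Config.Represents { c with head := some (p + dirInt d, q', c.tape (p + dirInt d)) } q'
      (T.move d) := by
  obtain ⟨p', b, h1, h2, h3, h4, h5⟩ := h
  rw [hc] at h1
  simp only [Option.some.injEq, Prod.mk.injEq, true_and] at h1
  obtain ⟨rfl, rfl⟩ := h1
  refine ⟨_, _, rfl, h₁, h₂, h4, fun k => ?_⟩
  rw [move_nth, h5, ← ha, Function.update_eq_self]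
  change _ = Function.update c.tape _ _ _
  rw [Function.update_eq_self]
  congr 1
  ring

/-- The represented tape already shows the symbol of the head at `p`. -/
theorem Config.Represents.store {c : Config Γ Q} {p : ℤ} {q : Q} {a : Γ} {T : Tape Γ}
    (h : c.Represents q T) (hc : c.head = some (p, q, a)) :
    Config.Represents { c with tape := Function.update c.tape p a } q T := by
  obtain ⟨p', b, h1, h2, h3, h4, h5⟩ := h
  rw [hc] at h1
  simp only [Option.some.injEq, Prod.mk.injEq, true_and] at h1
  obtain ⟨rfl, rfl⟩ := h1
  refine ⟨p, a, hc, h2, h3, fun i hi => ?_, fun k => ?_⟩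
  · change Function.update c.tape p a i = default
    rw [Function.update_of_ne, h4 i hi]
    rintro rfl
    exact hi ⟨h2, h3⟩
  · rw [h5]
    simp

theorem Config.Represents.extend {c : Config Γ Q} {q : Q} {T : Tape Γ} (h : c.Represents q T)
    {lo hi : ℤ} (hlo : lo ≤ c.lo) (hhi : c.hi ≤ hi) :
    Config.Represents { c with lo := lo, hi := hi } q T := by
  obtain ⟨p', b, h1, h2, h3, h4, h5⟩ := h
  exact ⟨p', b, h1, hlo.trans h2, h3.trans_le hhi, fun i hi => h4 i (by simp only at hi; omega), h5⟩

theorem Config.Represents.head_eq {c : Config Γ Q} {p : ℤ} {q q' : Q} {a : Γ} {T : Tape Γ}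
    (h : c.Represents q' T) (hc : c.head = some (p, q, a)) :
    q' = q ∧ T.head = a ∧ c.lo ≤ p ∧ p < c.hi ∧
      ∀ i, ¬ (c.lo ≤ i ∧ i < c.hi) → c.tape i = default := by
  obtain ⟨p', b, h1, h2, h3, h4, h5⟩ := h
  rw [hc] at h1
  simp only [Option.some.injEq, Prod.mk.injEq] at h1
  obtain ⟨rfl, rfl, rfl⟩ := h1
  have := h5 0
  simp at this
  exact ⟨rfl, this, h2, h3, h4⟩

end Representation

/-! ### Plans correspond to runs of the machine -/

section Simulation

/-- Plans can be followed on graphs instead of iterated products, since strong homomorphisms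
preserve plans and the hubs correspond. -/
theorem Rule.Step.achieves {m N : ℕ} {U Λ : Type} [Finite Λ] {hm : 2 ≤ m} {r : Rule m N Λ}
    {G G' : LGraph U Λ} (h : r.Step G G') {g : Formula m N} {l : List (Action m N)} :
    Achieves g (r.action hm :: l) _ (G.model m) (.inl none) ↔
      Achieves g l _ (G'.model m) (.inl none) := by
  obtain ⟨h₀, D, A, u, h₁, hD, hA⟩ := h
  have hh := strongHom_rewrite (hm := hm) h₁ h₀ hD hA
  have hp : (G.model m).Sat (.inl none) ((r.action hm).pre (r.action hm).actual) :=
    ⟨(sat_sortF G).2 rfl, h₀⟩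
  have key := hh.achieves (g := g) (l := l) (x := ⟨(.inl none, (r.action hm).actual), hp⟩)
    (y := .inl none) ⟨rfl, (by decide : (0 : Fin 6) ≠ 5)⟩
  rw [← key]
  exact ⟨fun ⟨_, h⟩ => h, fun h => ⟨hp, h⟩⟩

variable {Γ Q : Type} [Inhabited Γ] {m N : ℕ} [Finite Γ] [Finite Q]

/-- All elements of a finite type. -/
noncomputable def allOf (α : Type) [Finite α] : List α :=
  letI := Fintype.ofFinite α
  (Finset.univ : Finset α).toList

@[simp] theorem mem_allOf {α : Type} [Finite α] (x : α) : x ∈ allOf α := by simp [allOf]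

/-- The rules for a transition. -/
noncomputable def transitionRules (hm : 2 ≤ m) (q : Q) (a : Γ) (b : Γ) :
    Option (Q × TM0.Stmt Γ) → List (Rule m N (TapeLabel Γ Q))
  | none => []
  | some (q', .write a') => [writeRule hm q a q' a']
  | some (q', .move d) => [moveRule hm (dirInt d) q a q' b]

variable [Inhabited Q] (M : TM0.Machine Γ Q)

variable (N) in
/-- The rules that do not depend on the input. -/
noncomputable def machineRules (hm : 2 ≤ m) : List (Rule m N (TapeLabel Γ Q)) :=
  firstRule Γ Q hm :: ((allOf (ZMod 3 × Γ)).map (fun x => appendRule Q hm x.1 x.2) ++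
    (allOf (Q × Γ × Γ)).flatMap (fun x => transitionRules hm x.1 x.2.1 x.2.2 (M x.1 x.2.1)) ++
    (allOf (Q × Γ × ZMod 3)).map (fun x => storeRule hm x.1 x.2.1 x.2.2) ++
    (allOf (Dir × Q × Γ × ZMod 3)).map fun x => extendRule hm (dirInt x.1) x.2.1 x.2.2.1 x.2.2.2)

variable {M} {hm : 2 ≤ m}

theorem mem_machineRules {R : Rule m N (TapeLabel Γ Q)} :
    R ∈ machineRules N M hm ↔ R = firstRule Γ Q hm ∨ (∃ r a, R = appendRule Q hm r a) ∨
      (∃ q a q' a', M q a = some (q', .write a') ∧ R = writeRule hm q a q' a') ∨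
      (∃ q a q' d b, M q a = some (q', .move d) ∧ R = moveRule hm (dirInt d) q a q' b) ∨
      (∃ q a r, R = storeRule hm q a r) ∨ ∃ d q a r, R = extendRule hm (dirInt d) q a r := by
  have hT : (∃ q a b, R ∈ transitionRules hm q a b (M q a)) ↔
      (∃ q a q' a', M q a = some (q', .write a') ∧ R = writeRule hm q a q' a') ∨
      (∃ q a q' d b, M q a = some (q', .move d) ∧ R = moveRule hm (dirInt d) q a q' b) := by
    constructor
    · rintro ⟨q, a, b, h⟩
      rcases hM : M q a with _ | ⟨q', d | a'⟩ <;> rw [hM] at h <;> simp [transitionRules] at h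
      · exact .inr ⟨q, a, q', d, b, hM, h⟩
      · exact .inl ⟨q, a, q', a', hM, h⟩
    · rintro (⟨q, a, q', a', hM, h⟩ | ⟨q, a, q', d, b, hM, h⟩)
      -- The rule for a write ignores the third symbol, so any value will do.
      · exact ⟨q, a, default, by rw [hM]; simp [transitionRules, h]⟩
      · exact ⟨q, a, b, by rw [hM]; simp [transitionRules, h]⟩
  rw [← or_assoc (a := ∃ q a q' a', _), ← hT]
  simp only [machineRules, List.mem_cons, List.mem_append, List.mem_map, List.mem_flatMap,
    mem_allOf, true_and, Prod.exists, or_assoc, eq_comm]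

variable (M) in
/-- The configuration represents a configuration of the machine that is reachable from the initial
tape `l`, or it has no head and its tape starts at `0`. -/
def Config.Valid (l : List Γ) (c : Config Γ Q) : Prop :=
  (c.head = none ∧ c.lo = 0 ∧ 0 ≤ c.hi ∧ ∀ i, ¬ (c.lo ≤ i ∧ i < c.hi) → c.tape i = default) ∨
    ∃ q T, TM0.Reaches M (TM0.init l) ⟨q, T⟩ ∧ c.Represents q T

theorem Config.Valid.exists_represents {c : Config Γ Q} {l : List Γ} (h : c.Valid M l) {p : ℤ}
    {q : Q} {a : Γ} (hc : c.head = some (p, q, a)) :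
    ∃ T, TM0.Reaches M (TM0.init l) ⟨q, T⟩ ∧ c.Represents q T ∧ T.head = a ∧
      (c.lo ≤ p ∧ p < c.hi) ∧ ∀ i, ¬ (c.lo ≤ i ∧ i < c.hi) → c.tape i = default := by
  rcases h with ⟨h, -⟩ | ⟨q', T, h1, h2⟩
  · rw [hc] at h; simp at h
  · obtain ⟨rfl, h3, h4, h5, h6⟩ := h2.head_eq hc
    exact ⟨T, h1, h2, h3, ⟨h4, h5⟩, h6⟩

/-- Soundness. Without a head, rules only lengthen the tape or start the machine on the right input;
with one, writes and moves perform a machine step, while storing and extending do not change what is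
represented. -/
theorem Config.Valid.exists_step {c : Config Γ Q} {a₀ : Γ} {l : List Γ} (h : c.Valid M (a₀ :: l))
    {R : Rule m N (TapeLabel Γ Q)} (hR : R ∈ startRule hm default a₀ l :: machineRules N M hm)
    (hs : (c.graph.model m).Sat (.inl none) R.cond) :
    ∃ c' : Config Γ Q, R.Step c.graph c'.graph ∧ c'.Valid M (a₀ :: l) := by
  rw [List.mem_cons, mem_machineRules] at hR
  rcases hR with rfl | rfl | ⟨r, a, rfl⟩ | ⟨q, a, q', a', hM, rfl⟩ | ⟨q, a, q', d, b, hM, rfl⟩ |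
    ⟨q, a, r, rfl⟩ | ⟨d, q, a, r, rfl⟩
  · obtain ⟨h0, h1, h2, h3⟩ := sat_start_cond hs
    rcases h with ⟨-, h4, h5, h6⟩ | ⟨q, T, -, p, a, h4, -⟩
    · exact ⟨_, step_start h0 h1 h2 h3, .inr ⟨_, _, .refl, represents_init h4 h6 h2 h3⟩⟩
    · rw [h0] at h4; simp at h4
  · obtain ⟨h0, h1⟩ := sat_first_cond hs
    rcases h with ⟨-, h4, h5, h6⟩ | ⟨q, T, -, p, a, h4, -⟩
    · refine ⟨_, step_first h0 h4 (by omega) (h6 0 (by omega)), .inl ⟨h0, h4, zero_le_one, ?_⟩⟩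
      intro i hi
      exact h6 i (by simp only at hi; omega)
    · rw [h0] at h4; simp at h4
  · obtain ⟨h0, h1, rfl⟩ := sat_append_cond hs
    rcases h with ⟨-, h4, h5, h6⟩ | ⟨q, T, -, p, a, h4, -⟩
    · refine ⟨_, step_append h0 h1, .inl ⟨h0, h4, by simp only; omega, ?_⟩⟩
      intro i hi
      simp only at hi ⊢
      rw [Function.update_of_ne (by omega), h6 i (by omega)]
    · rw [h0] at h4; simp at h4
  · obtain ⟨p, hp⟩ := sat_write_cond hs
    obtain ⟨T, h1, h2, rfl, -, -⟩ := h.exists_represents hp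
    refine ⟨_, step_write hp, .inr ⟨_, _, h1.tail ?_, h2.write hp⟩⟩
    simp [TM0.step, hM]
  · have hd := dirInt_cases d
    obtain ⟨p, hp, h3, h4, h5, h6⟩ := sat_move_cond hd hs
    obtain ⟨T, h1, h2, rfl, ⟨h7, h8⟩, -⟩ := h.exists_represents hp
    refine ⟨_, step_move hd hp h7 h8 h5 h6 h3 h4, .inr ⟨_, _, h1.tail ?_, h4 ▸ h2.move hp h3 h5 h6⟩⟩
    simp [TM0.step, hM]
  · obtain ⟨p, hp, rfl⟩ := sat_store_cond hs
    obtain ⟨T, h1, h2, -, ⟨h7, h8⟩, -⟩ := h.exists_represents hp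
    exact ⟨_, step_store hp h7 h8, .inr ⟨_, _, h1, h2.store hp⟩⟩
  · have hd := dirInt_cases d
    obtain ⟨p, hp, rfl, h7, h8, h9⟩ := sat_extend_cond hd hs
    obtain ⟨T, h1, h2, -, -, h10⟩ := h.exists_represents hp
    exact ⟨_, step_extend hd hp h7 h8 h9 (h10 _ h9),
      .inr ⟨_, _, h1, h2.extend (min_le_left _ _) (le_max_left _ _)⟩⟩

variable (N M hm) in
/-- The machine has halted. -/
noncomputable def haltF : Formula m N :=
  someF (TapeLabel Γ Q) hm (labF fun x : TapeLabel Γ Q => ∃ q a, M q a = none ∧ x = .inr (q, a))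

theorem sat_haltF {c : Config Γ Q} :
    (c.graph.model m).Sat (.inl none) (haltF N M hm) ↔
      ∃ p q a, c.head = some (p, q, a) ∧ M q a = none := by
  rw [haltF, sat_someF]
  simp only [sat_labF]
  constructor
  · rintro ⟨_ | i, h, q, a, h1, h2⟩
    · obtain ⟨⟨p, x⟩, hx⟩ := h
      rw [Config.lab_none hx] at h2
      simp only [Sum.inr.injEq] at h2
      subst h2
      exact ⟨p, q, a, hx, h1⟩
    · simp at h2
  · rintro ⟨p, q, a, h1, h2⟩
    exact ⟨none, ⟨_, h1⟩, q, a, h2, Config.lab_none h1⟩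

theorem machineHalts_of_achieves {a₀ : Γ} {l : List Γ} {P : List (Action m N)}
    (hP : ∀ X ∈ P, ∃ R ∈ startRule hm default a₀ l :: machineRules N M hm, X = R.action hm) :
    ∀ {c : Config Γ Q}, c.Valid M (a₀ :: l) →
      Achieves (haltF N M hm) P _ (c.graph.model m) (.inl none) → MachineHalts M (a₀ :: l) := by
  induction P with
  | nil =>
    intro c hc h
    obtain ⟨p, q, a, h1, h2⟩ := sat_haltF.1 h
    obtain ⟨T, h3, h4, rfl, -⟩ := hc.exists_represents h1
    exact ⟨_, h3, by simp [TM0.step, h2]⟩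
  | cons X P ih =>
    intro c hc h
    obtain ⟨R, hR, rfl⟩ := hP X (by simp)
    obtain ⟨c', h1, h2⟩ := hc.exists_step hR h.1.2
    exact ih (fun Y hY => hP Y (by simp [hY])) h2 (h1.achieves.1 h)

variable (M hm N) in
/-- A halting configuration can be reached with the rules. -/
def CanHalt (a₀ : Γ) (l : List Γ) (c : Config Γ Q) : Prop :=
  ∃ P : List (Action m N),
    (∀ X ∈ P, ∃ R ∈ startRule hm default a₀ l :: machineRules N M hm, X = R.action hm) ∧
    Achieves (haltF N M hm) P _ (c.graph.model m) (.inl none)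

theorem CanHalt.of_step {a₀ : Γ} {l : List Γ} {c c' : Config Γ Q} (h : CanHalt N M hm a₀ l c')
    {R : Rule m N (TapeLabel Γ Q)} (hR : R ∈ startRule hm default a₀ l :: machineRules N M hm)
    (hs : R.Step c.graph c'.graph) : CanHalt N M hm a₀ l c := by
  obtain ⟨P, h1, h2⟩ := h
  refine ⟨R.action hm :: P, ?_, hs.achieves.2 h2⟩
  intro X hX
  rcases List.mem_cons.1 hX with rfl | hX
  · exact ⟨R, hR, rfl⟩
  · exact h1 X hX

/-- Store, extend if the target cell is missing, then move. The steps are composed from the last to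
the first, as `CanHalt` is inherited by predecessors. -/
theorem canHalt_move {a₀ : Γ} {l : List Γ} {c : Config Γ Q} {p : ℤ} {q q' : Q} {a : Γ} {T : Tape Γ}
    {d : Dir} (hM : M q a = some (q', .move d)) (hr : c.Represents q T)
    (hc : c.head = some (p, q, a))
    (ih : ∀ c' : Config Γ Q, c'.Represents q' (T.move d) → CanHalt N M hm a₀ l c') :
    CanHalt N M hm a₀ l c := by
  have hd := dirInt_cases d
  -- the cell in the target position exists, and the scanned cell is up to date
  have key : ∀ c : Config Γ Q, c.Represents q T → c.head = some (p, q, a) → c.tape p = a →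
      c.lo ≤ p + dirInt d → p + dirInt d < c.hi → CanHalt N M hm a₀ l c := by
    intro c hr hc ha h1 h2
    obtain ⟨-, -, h3, h4, -⟩ := hr.head_eq hc
    exact (ih _ (hr.move hc ha h1 h2)).of_step
      (List.mem_cons_of_mem _ (mem_machineRules.2 (.inr (.inr (.inr (.inl ⟨_, _, _, _, _, hM, rfl⟩))))))
      (step_move hd hc h3 h4 h1 h2 ha rfl)
  have key' : ∀ c : Config Γ Q, c.Represents q T → c.head = some (p, q, a) → c.tape p = a →
      CanHalt N M hm a₀ l c := by
    intro c hr hc ha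
    obtain ⟨-, -, h3, h4, h5⟩ := hr.head_eq hc
    by_cases h6 : c.lo ≤ p + dirInt d ∧ p + dirInt d < c.hi
    · exact key c hr hc ha h6.1 h6.2
    · refine (key { c with lo := min c.lo (p + dirInt d), hi := max c.hi (p + dirInt d + 1) }
        (hr.extend (min_le_left _ _) (le_max_left _ _)) hc ha (min_le_right _ _)
        (lt_of_lt_of_le (lt_add_one _) (le_max_right _ _))).of_step
        (List.mem_cons_of_mem _ (mem_machineRules.2 (.inr (.inr (.inr (.inr (.inr ⟨d, q, a, p, rfl⟩)))))))
        (step_extend hd hc h3 h4 h6 (h5 _ h6))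
  obtain ⟨-, -, h3, h4, -⟩ := hr.head_eq hc
  exact (key' _ (hr.store hc) hc (Function.update_self _ _ _)).of_step
    (List.mem_cons_of_mem _ (mem_machineRules.2 (.inr (.inr (.inr (.inr (.inl ⟨q, a, p, rfl⟩)))))))
    (step_store hc h3 h4)

/-- The induction ranges over all representing configurations: the machine determines neither the
extent of the finite tape nor the possibly outdated content of the scanned cell. -/
theorem canHalt_of_reaches {a₀ : Γ} {l : List Γ} {s t : TM0.Cfg Γ Q} (h : TM0.Reaches M s t)
    (ht : TM0.step M t = none) :
    ∀ {c : Config Γ Q}, c.Represents s.q s.Tape → CanHalt N M hm a₀ l c := by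
  induction h using Relation.ReflTransGen.head_induction_on with
  | refl =>
    intro c hc
    obtain ⟨q, T⟩ := t
    obtain ⟨p, a, h1, -⟩ := id hc
    obtain ⟨-, rfl, -⟩ := hc.head_eq h1
    refine ⟨[], by simp, sat_haltF.2 ⟨p, q, _, h1, ?_⟩⟩
    simpa [TM0.step] using ht
  | head h hst ih =>
    rename_i s s'
    intro c hc
    obtain ⟨q, T⟩ := s
    obtain ⟨p, a, h1, -⟩ := id hc
    obtain ⟨-, rfl, -⟩ := hc.head_eq h1
    simp only [TM0.step, Option.mem_def, Option.map_eq_some_iff] at h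
    obtain ⟨⟨q', d | a'⟩, hM, rfl⟩ := h
    · exact canHalt_move hM hc h1 fun c' hc' => ih hc'
    · exact (ih (hc.write h1)).of_step
        (List.mem_cons_of_mem _ (mem_machineRules.2 (.inr (.inr (.inl ⟨_, _, _, _, hM, rfl⟩)))))
        (step_write h1)

/-- In continuation form, so that the configuration reached need only be known by its relevant
properties. -/
theorem canHalt_of_append {a₀ : Γ} {l : List Γ} : ∀ (l' : List Γ) {c : Config Γ Q}, c.head = none →
    c.lo < c.hi →
    (∀ c' : Config Γ Q, c'.head = none → c'.lo = c.lo → c'.hi = c.hi + l'.length →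
      (∀ i, i < c.hi ∨ c'.hi ≤ i → c'.tape i = c.tape i) →
      (∀ j : ℕ, ∀ h : j < l'.length, c'.tape (c.hi + j) = l'[j]) → CanHalt N M hm a₀ l c') →
    CanHalt N M hm a₀ l c := by
  intro l'
  induction l' with
  | nil =>
    intro c h0 h1 h
    exact h c h0 rfl (by simp) (fun _ _ => rfl) (by simp)
  | cons a l' ih =>
    intro c h0 h1 h
    refine (ih (c := { c with hi := c.hi + 1, tape := Function.update c.tape c.hi a }) h0
      (by simp only; omega) ?_).of_step
      (List.mem_cons_of_mem _ (mem_machineRules.2 (.inr (.inl ⟨_, _, rfl⟩)))) (step_append h0 h1)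
    intro c' h2 h3 h4 h5 h6
    simp only at h3 h4 h5 h6
    refine h c' h2 h3 (by rw [h4, List.length_cons]; push_cast; ring) ?_ ?_
    · intro i hi
      rw [h5 i (by omega), Function.update_of_ne (by omega)]
    · rintro (_ | j) hj
      · rw [h5 _ (by simp)]
        simp
      · rw [List.getElem_cons_succ, ← h6 j (by simpa using hj)]
        congr 1; push_cast; ring

variable (Γ Q) in
/-- The configuration without cells and head. -/
def emptyConfig : Config Γ Q := ⟨0, 0, fun _ => default, none⟩

theorem canHalt_emptyConfig_iff {a₀ : Γ} {l : List Γ} :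
    CanHalt N M hm a₀ l (emptyConfig Γ Q) ↔ MachineHalts M (a₀ :: l) := by
  constructor
  · rintro ⟨P, h1, h2⟩
    exact machineHalts_of_achieves h1 (.inl ⟨rfl, rfl, le_rfl, fun _ _ => rfl⟩) h2
  · rintro ⟨t, h1, h2⟩
    -- The plan makes a first cell, appends the cells of `l`, creates the head and then follows the
    -- run.
    refine CanHalt.of_step (c' := { emptyConfig Γ Q with hi := 1 }) ?_
      (List.mem_cons_of_mem _ (mem_machineRules.2 (.inl rfl))) (step_first rfl rfl rfl rfl)
    refine canHalt_of_append l rfl zero_lt_one ?_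
    intro c' h0 h3 h4 h5 h6
    change c'.lo = 0 at h3
    change c'.hi = 1 + l.length at h4
    have h7 : ∀ j : ℕ, ∀ h : j < l.length, c'.tape (c'.lo + 1 + j) = l[j] := by
      intro j hj
      rw [h3, ← h6 j hj]
      rfl
    have h8 : ∀ i, ¬ (c'.lo ≤ i ∧ i < c'.hi) → c'.tape i = default := by
      intro i hi
      refine h5 i ?_
      change i < 1 ∨ _
      omega
    exact (canHalt_of_reaches h1 h2 (represents_init h3 h8 (by omega) h7)).of_step
      List.mem_cons_self (step_start h0 (by omega) (by omega) h7)

end Simulation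

/-! ### The planning task of an input -/

section Tasks

variable {Γ Q : Type} [Inhabited Γ] [Finite Γ] [Finite Q] [Inhabited Q] {m N : ℕ}

variable (Γ Q m) in
/-- The model of the configuration without cells and head, on an initial segment of the natural
numbers. -/
noncomputable def initialModel : Model m (Fin (Nat.card (WorldSort (TapeLabel Γ Q)))) where
  rel i x y := ((emptyConfig Γ Q).graph.model m).rel i (.inl ((sortEquiv _).symm x))
    (.inl ((sortEquiv _).symm y))
  val p := {x | .inl ((sortEquiv _).symm x) ∈ ((emptyConfig Γ Q).graph.model m).val p}
  att _ _ := 0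

/-- Without vertices, agent 0 just identifies all spare copies and the other agents have the total
relation; transitivity is lost only through updates. -/
theorem initialModel_isAttentionModel : (initialModel Γ Q m).IsAttentionModel N where
  finite := inferInstance
  equivalence i := by
    by_cases hi : i.1 = 0
    · have h : ∀ x y, (initialModel Γ Q m).rel i x y ↔
          (sortEquiv _).symm x = (sortEquiv _).symm y ∨
            IsLabel ((sortEquiv (TapeLabel Γ Q)).symm x) ∧ IsLabel ((sortEquiv _).symm y) := by
        intro x y
        simp [initialModel, LGraph.model, hi, LGraph.rel₀]
      refine ⟨fun x => (h x x).2 (.inl rfl), fun {x y} h' => ?_, fun {x y z} h1 h2 => ?_⟩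
      · rw [h] at h' ⊢
        rcases h' with h' | h'
        · exact .inl h'.symm
        · exact .inr h'.symm
      · rw [h] at h1 h2 ⊢
        rcases h1 with h1 | h1 <;> rcases h2 with h2 | h2
        · exact .inl (h1.trans h2)
        · exact .inr (h1 ▸ h2)
        · exact .inr (h2 ▸ h1)
        · exact .inr ⟨h1.1, h2.2⟩
    · have h : ∀ x y, (initialModel Γ Q m).rel i x y := by
        intro x y
        simp [initialModel, LGraph.model, hi, LGraph.rel₁]
      exact ⟨fun _ => h _ _, fun _ => h _ _, fun _ _ => h _ _⟩
  att_le _ _ := Nat.zero_le _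
  att_eq _ _ _ _ := rfl

theorem strongHom_initialModel :
    StrongHom (initialModel Γ Q m) ((emptyConfig Γ Q).graph.model m)
      fun x y => y = .inl ((sortEquiv _).symm x) where
  total x := ⟨_, rfl⟩
  surj := by
    rintro (a | ⟨_ | i, h⟩)
    · exact ⟨sortEquiv _ a, by simp⟩
    · obtain ⟨x, hx⟩ := h
      simp [emptyConfig] at hx
    · have h' : (0 : ℤ) ≤ i ∧ i < 0 := h
      omega
  rel := by rintro i x y _ _ rfl rfl; rfl
  val := by rintro p x _ rfl; rfl
  att := by rintro i x _ rfl; rfl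

variable (N) (M : TM0.Machine Γ Q) (hm : 2 ≤ m) (a₀ : Γ)

/-- The task of halting the machine on the tape `a₀ :: l`. -/
noncomputable def haltingTask (l : List Γ) : Task m N where
  size := Nat.card (WorldSort (TapeLabel Γ Q))
  model := initialModel Γ Q m
  isAttentionModel := initialModel_isAttentionModel
  world := sortEquiv _ none
  actions := (startRule hm default a₀ l :: machineRules N M hm).map (Rule.action hm)
  goal := haltF N M hm

theorem haltingTask_hasSolution (l : List Γ) :
    (haltingTask N M hm a₀ l).HasSolution ↔ MachineHalts M (a₀ :: l) := by
  rw [← canHalt_emptyConfig_iff (N := N) (hm := hm)]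
  refine exists_congr fun P => and_congr (forall₂_congr fun X _ => ?_) ?_
  · simp only [haltingTask, List.mem_map, eq_comm]
  · exact strongHom_initialModel.achieves (by simp [haltingTask])

end Tasks

/-! ### How the description of the task depends on the input -/

section Descriptions

theorem bound_labF {m N : ℕ} {Λ : Type} [Finite Λ] (P P' : Λ → Prop) :
    (labF P : Formula m N).bound = (labF P' : Formula m N).bound := by
  rw [labF, labF]
  generalize (@Finset.univ Λ (Fintype.ofFinite Λ)).toList = l
  induction l with
  | nil => rfl
  | cons x l ih =>
    simp only [List.foldr_cons, disj, Formula.bound] at ih ⊢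
    rw [ih]
    split_ifs <;> rfl

variable {Γ Q : Type} [Inhabited Γ] [Finite Γ] [Finite Q] {m N : ℕ} (hm : 2 ≤ m)

/-- The description tabulates the valuation below `Task.bound`, so this table must not vary with the
input. -/
theorem bound_contentF (l : List Γ) :
    (contentF Q hm l : Formula m N).bound = (contentF Q hm ([] : List Γ) : Formula m N).bound := by
  have hr : ∀ r : ZMod 3, (resF Γ Q r : Formula m N).bound =
    (labF (fun _ : TapeLabel Γ Q => True) : Formula m N).bound := fun r => bound_labF _ _
  have hs : ∀ b : Γ, (symF Q b : Formula m N).bound =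
    (labF (fun _ : TapeLabel Γ Q => True) : Formula m N).bound := fun b => bound_labF _ _
  induction l with
  | nil => rfl
  | cons b l ih =>
    simp only [contentF, shiftF, disj, nearF, dia, Formula.bound, hr, hs] at ih ⊢
    rw [ih]
    omega

/-- The formula occurs once for each residue. Iteration makes codes exponentially long in the length
of the list, which is harmless for computability. -/
theorem code_shiftF : ∃ u₁ u₂ u₃ : List ℕ, ∀ φ : Formula m N,
    (shiftF Γ Q hm 1 φ).code = u₁ ++ φ.code ++ u₂ ++ φ.code ++ u₃ ++ φ.code := by
  -- The tags are those of `Formula.code`: 4 negation, 5 conjunction, 6 knowledge, here followed by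
  -- agent 0.
  refine ⟨4 :: 5 :: 4 :: 5 :: ((resF Γ Q 0 : Formula m N).code ++
      4 :: 6 :: 0 :: 4 :: 5 :: ((vertexF (TapeLabel Γ Q) hm : Formula m N).code ++
        5 :: (resF Γ Q (0 + (1 : ℤ)) : Formula m N).code)),
    4 :: 4 :: 5 :: 4 :: 5 :: ((resF Γ Q 1 : Formula m N).code ++
      4 :: 6 :: 0 :: 4 :: 5 :: ((vertexF (TapeLabel Γ Q) hm : Formula m N).code ++
        5 :: (resF Γ Q (1 + (1 : ℤ)) : Formula m N).code)),
    4 :: 5 :: ((resF Γ Q 2 : Formula m N).code ++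
      4 :: 6 :: 0 :: 4 :: 5 :: ((vertexF (TapeLabel Γ Q) hm : Formula m N).code ++
        5 :: (resF Γ Q (2 + (1 : ℤ)) : Formula m N).code)), fun φ => ?_⟩
  simp only [shiftF, disj, nearF, dia, adjAgent, Formula.code, List.append_assoc, List.cons_append]

variable (q : Q) (a : Γ)

theorem code_startRule : ∃ u : List ℕ, ∀ l : List Γ,
    ((startRule hm q a l : Rule m N (TapeLabel Γ Q)).pre hm 0).code =
      u ++ (contentF Q hm l : Formula m N).code := by
  refine ⟨5 :: ((sortF (none : WorldSort (TapeLabel Γ Q)) : Formula m N).code ++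
    5 :: ((.neg (someF (TapeLabel Γ Q) hm (headF Γ Q)) : Formula m N).code ++
    4 :: 6 :: 1 :: 4 :: 5 :: ((vertexF (TapeLabel Γ Q) hm : Formula m N).code ++
    5 :: (.and (cellF Γ Q) (.neg (shiftF Γ Q hm (-1) .top)) : Formula m N).code))), fun l => ?_⟩
  simp only [Rule.pre, Matrix.cons_val_zero, startRule, someF, dia, hubAgent, Formula.code,
    List.append_assoc, List.cons_append]

/-- The list enters the rule only through `cond`, which is tested only at the hub event. -/
theorem pre_startRule_succ (l : List Γ) (e : Fin 5) :
    (startRule hm q a l : Rule m N (TapeLabel Γ Q)).pre hm e.succ =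
      (startRule hm q a [] : Rule m N (TapeLabel Γ Q)).pre hm e.succ := by
  fin_cases e <;> rfl

theorem bound_startRule (l : List Γ) :
    ((startRule hm q a l : Rule m N (TapeLabel Γ Q)).action hm).bound =
      ((startRule hm q a [] : Rule m N (TapeLabel Γ Q)).action hm).bound := by
  have h : ∀ e : Fin 6, ((startRule hm q a l : Rule m N (TapeLabel Γ Q)).pre hm e).bound =
      ((startRule hm q a [] : Rule m N (TapeLabel Γ Q)).pre hm e).bound := by
    intro e
    refine Fin.cases ?_ (fun e => ?_) e
    · simp only [Rule.pre, Matrix.cons_val_zero, startRule, someF, dia, Formula.bound]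
      rw [bound_contentF]
    · rw [pre_startRule_succ]
  exact Finset.sup_congr rfl fun e _ => h e

theorem code_action_startRule : ∃ (x₁ : ℕ) (x₂ x₃ : List (List (List Bool))) (u : List ℕ)
    (x₄ x₅ x₆ : List (List ℕ)) (x₇ : ℕ), ∀ l : List Γ,
    ((startRule hm q a l : Rule m N (TapeLabel Γ Q)).action hm).code =
      (x₁, x₂, x₃, (u ++ (contentF Q hm l : Formula m N).code) :: x₄, x₅, x₆, x₇) := by
  obtain ⟨u, hu⟩ := code_startRule (N := N) hm q a
  let X : Action m N := (startRule hm q a [] : Rule m N (TapeLabel Γ Q)).action hm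
  refine ⟨X.size, List.ofFn fun i => table (X.Q i), List.ofFn fun i => table (X.Qstar i), u,
    List.ofFn fun e : Fin 5 => (X.pre e.succ).code, List.ofFn fun i => (X.question i).code,
    values fun i e => X.cost i (X.question i) e, X.actual, fun l => ?_⟩
  have h : (List.ofFn fun e => ((startRule hm q a l : Rule m N (TapeLabel Γ Q)).pre hm e).code) =
      (u ++ (contentF Q hm l : Formula m N).code) ::
        List.ofFn fun e : Fin 5 =>
          ((startRule hm q a [] : Rule m N (TapeLabel Γ Q)).pre hm e.succ).code := by
    rw [List.ofFn_succ, hu]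
    simp only [pre_startRule_succ hm q a l]
  unfold Action.code
  refine congrArg₂ Prod.mk rfl (congrArg₂ Prod.mk rfl (congrArg₂ Prod.mk rfl
    (congrArg₂ Prod.mk h (congrArg₂ Prod.mk rfl (congrArg₂ Prod.mk rfl rfl)))))

variable [Inhabited Q] (M : TM0.Machine Γ Q)

/-- Everything is constant except one word, the precondition of the hub event of the starting
action. -/
theorem code_haltingTask : ∃ (y : ℕ × List (List (List Bool)) × List (List Bool) × List (List ℕ) × ℕ)
    (z : List ActionCode) (w : List ℕ) (x₁ : ℕ) (x₂ x₃ : List (List (List Bool))) (u : List ℕ)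
    (x₄ x₅ x₆ : List (List ℕ)) (x₇ : ℕ), ∀ l : List Γ,
    (haltingTask N M hm a l).code =
      (y, (x₁, x₂, x₃, (u ++ (contentF Q hm l : Formula m N).code) :: x₄, x₅, x₆, x₇) :: z, w) := by
  obtain ⟨x₁, x₂, x₃, u, x₄, x₅, x₆, x₇, h⟩ := code_action_startRule (N := N) hm (default : Q) a
  refine ⟨(haltingTask N M hm a []).code.1,
    ((machineRules N M hm).map (Rule.action hm)).map Action.code, (haltF N M hm).code,
    x₁, x₂, x₃, u, x₄, x₅, x₆, x₇, fun l => ?_⟩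
  have hb : (haltingTask N M hm a l).bound = (haltingTask N M hm a []).bound := by
    simp only [Task.bound, haltingTask, List.map_cons, List.foldr_cons]
    rw [bound_startRule]
  have hv : ∀ b b' : ℕ, b = b' →
      table (fun (p : Fin b) w => w ∈ (initialModel Γ Q m).val p) =
        table (fun (p : Fin b') w => w ∈ (initialModel Γ Q m).val p) := by
    rintro b _ rfl; rfl
  rw [← h]
  exact congrArg₂ Prod.mk (congrArg₂ Prod.mk rfl (congrArg₂ Prod.mk rfl
    (congrArg₂ Prod.mk (hv _ _ hb) rfl))) rfl

end Descriptions

/-! ### The description is computable from the input -/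

section Computability

theorem bits_eq (n : ℕ) : n.bits = if n = 0 then [] else n.bodd :: n.div2.bits := by
  split_ifs with h
  · simp [h]
  · conv_lhs => rw [← Nat.bit_bodd_div2 n]
    refine Nat.bits_append_bit _ _ fun h' => ?_
    by_contra hb
    have := Nat.bit_bodd_div2 n
    rw [h'] at this
    simp only [Bool.not_eq_true] at hb
    rw [hb] at this
    exact h (this.symm.trans (by simp))

theorem primrec_bits : Primrec Nat.bits := by
  have h : Primrec₂ fun (_ : Unit) (n : ℕ) => n.bits := by
    -- Here `l` lists the bits of all smaller numbers, so `l.length` is the current number and its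
    -- half is an index into `l`.
    refine Primrec.nat_strong_rec _ (g := fun _ l => if l.length = 0 then some [] else
      (l[l.length.div2]?).map fun t => l.length.bodd :: t) ?_ ?_
    · have hl : Primrec fun x : Unit × List (List Bool) => x.2.length :=
        Primrec.list_length.comp Primrec.snd
      refine Primrec.ite (Primrec.eq.comp hl (Primrec.const 0)) (Primrec.const _) ?_
      refine Primrec.option_map (Primrec.list_getElem?.comp Primrec.snd (Primrec.nat_div2.comp hl)) ?_
      exact Primrec.list_cons.comp (Primrec.nat_bodd.comp (hl.comp Primrec.fst)) Primrec.snd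
    · intro _ n
      simp only [List.length_map, List.length_range]
      rw [bits_eq n]
      split_ifs with hn
      · rfl
      · have : n.div2 < n := by
          rw [Nat.div2_val]; omega
        simp [this]
  exact h.comp (Primrec.const ()) Primrec.id

variable {Γ Q : Type} [Inhabited Γ] [Finite Γ] [Finite Q] {m : ℕ}

/-- By `code_shiftF` the code is a right fold that inserts the word obtained so far in three places
between constant words. -/
theorem primrec_code_contentF (N : ℕ) (hm : 2 ≤ m) (g : Bool → Γ) :
    Primrec fun l : List Bool => (contentF Q hm (l.map g) : Formula m N).code := by
  obtain ⟨u₁, u₂, u₃, hu⟩ := code_shiftF (Γ := Γ) (Q := Q) (N := N) hm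
  have hs : Primrec fun b : Bool => (symF Q (g b) : Formula m N).code := Primrec.dom_finite _
  have hy : Primrec fun x : List Bool × Bool × List ℕ =>
      5 :: ((symF Q (g x.2.1) : Formula m N).code ++ x.2.2) :=
    Primrec.list_cons.comp (Primrec.const 5) (Primrec.list_append.comp
      (hs.comp (Primrec.fst.comp Primrec.snd)) (Primrec.snd.comp Primrec.snd))
  have ha : ∀ {f f' : List Bool × Bool × List ℕ → List ℕ}, Primrec f → Primrec f' →
      Primrec fun x => f x ++ f' x := fun h h' => Primrec.list_append.comp h h'
  have h := Primrec.list_foldr (f := fun l : List Bool => l)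
    (g := fun _ => (contentF Q hm ([] : List Γ) : Formula m N).code)
    (h := fun _ x => u₁ ++ (5 :: ((symF Q (g x.1) : Formula m N).code ++ x.2)) ++ u₂ ++
      (5 :: ((symF Q (g x.1) : Formula m N).code ++ x.2)) ++ u₃ ++
      (5 :: ((symF Q (g x.1) : Formula m N).code ++ x.2))) Primrec.id (Primrec.const _)
    (ha (ha (ha (ha (ha (Primrec.const u₁) hy) (Primrec.const u₂)) hy) (Primrec.const u₃)) hy)
  refine h.of_eq fun l => ?_
  induction l with
  | nil => rfl
  | cons b l ih =>
    rw [List.foldr_cons, ih, List.map_cons, contentF, hu]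
    simp only [Formula.code]

theorem computable_code_haltingTask [Inhabited Q] (N : ℕ) (M : TM0.Machine Γ Q) (hm : 2 ≤ m) (a : Γ)
    (g : Bool → Γ) :
    Computable fun n : ℕ => (haltingTask N M hm a (n.bits.reverse.map g)).code := by
  obtain ⟨y, z, w, x₁, x₂, x₃, u, x₄, x₅, x₆, x₇, h⟩ := code_haltingTask (N := N) hm a M
  simp only [h]
  have hc : Primrec fun n : ℕ => (contentF Q hm (n.bits.reverse.map g) : Formula m N).code :=
    (primrec_code_contentF N hm g).comp (Primrec.list_reverse.comp primrec_bits)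
  have hc' : Computable fun n : ℕ =>
      (u ++ (contentF Q hm (n.bits.reverse.map g) : Formula m N).code) :: x₄ :=
    (Primrec.list_cons.comp (Primrec.list_append.comp (Primrec.const u) hc)
      (Primrec.const x₄)).to_comp
  exact (Computable.const y).pair ((Computable.list_cons.comp ((Computable.const x₁).pair
    ((Computable.const x₂).pair ((Computable.const x₃).pair (hc'.pair ((Computable.const x₅).pair
      ((Computable.const x₆).pair (Computable.const x₇))))))) (Computable.const z)).pair
        (Computable.const w))

end Computability

end AttentionPlanning

theorem theorem1 (m N : ℕ) (hm : 2 ≤ m) : ¬ AttentionPlanning.PlanExDecidable (AttentionPlanning.ALL m N) := by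
  rintro ⟨D, hD, h⟩
  obtain ⟨Γ, Q, h1, h2, h3, h4, M, a, g, hM⟩ := AttentionPlanning.exists_undecidable_machine
  -- The supposed algorithm, composed with the computable description, would decide halting.
  refine hM (ComputablePred.computable_iff.2 ⟨_, hD.comp
    (AttentionPlanning.computable_code_haltingTask N M hm a g), funext fun n => propext ?_⟩)
  rw [h _ fun _ _ => Set.mem_univ _, AttentionPlanning.haltingTask_hasSolution]
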